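/- **Notation.** Let $\mathcal S$ be the category of finite ordinals $\underline n=\{1,\dots,n\}$ and arbitrary maps. For $\varphi:\underline m\to\underline n$ and $i\in\underline n$ let $\varepsilon_{\varphi,i}:\varphi^{-1}(i)\to\underline m$ be the unique monotone injection in $\mathcal S$ with image $\{j:\varphi(j)=i\}$, and for $\psi:\underline\ell\to\underline m$ let $\psi^\varphi_i:(\varphi\psi)^{-1}(i)\to\varphi^{-1}(i)$ be the unique map with $\varepsilon_{\varphi,i}\,\psi^\varphi_i=\psi\,\varepsilon_{\varphi\psi,i}$. An *operadic category* is a small category $\mathcal C$ with a chosen terminal object in each connected component (write $\tau_X:X\to uX$ for the unique map to the chosen terminal object of the component of $X$), a functor $|{-}|:\mathcal C\to\mathcal S$, and for all $X\in\mathcal C$ and $i\in|X|$ a functor $\mathcal C/X\to\mathcal C$, written $f\mapsto f^{-1}(i)$ on objects and $(g:fg\to f)\mapsto (g^f_i:(fg)^{-1}(i)\to f^{-1}(i))$ on morphisms, such that: $|uX|=\underline 1$; each $(1_X)^{-1}(i)$ is a chosen terminal object; $|f^{-1}(i)|=|f|^{-1}(i)$ and $|g^f_i|=|g|^{|f|}_i$;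 $\tau_X^{-1}(\ast)=X$ and $f^{\tau_X}_\ast=f$; and, for $j\in|f|^{-1}(i)$ and $\varepsilon=\varepsilon_{|f|,i}$, $(g^f_i)^{-1}(j)=g^{-1}(\varepsilon j)$ and $(h^{fg}_i)^{g^f_i}_j=h^g_{\varepsilon j}$. It is *unary* if $|X|=\underline 1$ for all $X$. An *operadic functor* is a functor that strictly preserves chosen terminal objects, cardinalities, fibres $f^{-1}(i)$ and fibre maps $g^f_i$. Let $\mathrm{OpCat}_1$ be the category of unary operadic categories and operadic functors. The (upper) *décalage* $D(C)$ of a simplicial set $C$ is the composite of $C$ with (the opposite of) the functor $T:\Delta\to\Delta$, $[n]\mapsto[n+1]$, that freely adjoins a top element. A simplicial set satisfies the *Segal condition* if for every $n$ each chain of $n$ composable edges is the spine of exactly one $n$-simplex. **Corollary.** The category $\mathrm{OpCat}_1$ is equivalent to the full subcategory of $[\Delta^{\mathrm{op}},\mathrm{Set}]$ on those simplicial sets $C$ for which $D(C)$ satisfies the Segal condition. The equivalence can be chosen so that, if $C$ is the simplicial set corresponding to a unary operadic category $\mathcal C$, then $D(C)\cong \mathrm N(\mathcal C)$, the nerve of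 the underlying category, naturally in $\mathcal C$. Moreover, this full subcategory of $[\Delta^{\mathrm{op}},\mathrm{Set}]$ is reflective. -/

import Mathlib

open CategoryTheory Opposite

universe v u

namespace Operadic

/-! ### The category of finite ordinals and arbitrary maps -/

/-- The objects of the category `𝒮` of finite ordinals and arbitrary maps: for every natural
number `n` one object, standing for an `n`-element ordinal (here `Fin n`). -/
structure FinOrdinal : Type where
  /-- the number of elements -/
  n : ℕ

instance : SmallCategory FinOrdinal where
  Hom a b := Fin a.n → Fin b.n
  id _ := id
  comp f g := g ∘ f

/-- The object `1` of `𝒮`. -/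
def FinOrdinal.one : FinOrdinal := ⟨1⟩

namespace FinOrdinal

/-- The set of elements of `m` that `φ : m ⟶ n` sends to `i`. -/
def fibreSet {m n : FinOrdinal} (φ : m ⟶ n) (i : Fin n.n) : Finset (Fin m.n) :=
  Finset.univ.filter fun j => φ j = i

/-- The fibre `φ⁻¹(i)`, as an object of `𝒮`. -/
def fibre {m n : FinOrdinal} (φ : m ⟶ n) (i : Fin n.n) : FinOrdinal :=
  ⟨(fibreSet φ i).card⟩

/-- The unique monotone injection `ε : φ⁻¹(i) → m` with image `{j | φ j = i}`. -/
def fibreIncl {m n : FinOrdinal} (φ : m ⟶ n) (i : Fin n.n) : Fin (fibre φ i).n ↪o Fin m.n :=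
  (fibreSet φ i).orderEmbOfFin rfl

/-- The fibre map `(φψ)⁻¹(i) → φ⁻¹(i)` of `ψ` with respect to `φ` at `i`: the restriction of `ψ`
along the injections `ε` (see `fibreIncl_fibreMap`). -/
def fibreMap {l m n : FinOrdinal} (ψ : l ⟶ m) (φ : m ⟶ n) (i : Fin n.n) :
    fibre (ψ ≫ φ) i ⟶ fibre φ i := fun j =>
  ((fibreSet φ i).orderIsoOfFin rfl).symm
    ⟨ψ (fibreIncl (ψ ≫ φ) i j), by
      have h := (fibreSet (ψ ≫ φ) i).orderEmbOfFin_mem rfl j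
      exact Finset.mem_filter.2 ⟨Finset.mem_univ _, (Finset.mem_filter.1 h).2⟩⟩

theorem fibreIncl_fibreMap {l m n : FinOrdinal} (ψ : l ⟶ m) (φ : m ⟶ n) (i : Fin n.n)
    (j : Fin (fibre (ψ ≫ φ) i).n) :
    fibreIncl φ i (fibreMap ψ φ i j) = ψ (fibreIncl (ψ ≫ φ) i j) := by
  exact congrArg Subtype.val (((fibreSet φ i).orderIsoOfFin rfl).apply_symm_apply
    ⟨ψ (fibreIncl (ψ ≫ φ) i j), _⟩)

end FinOrdinal

/-! ### Operadic categories -/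

/-- A category endowed with local terminal objects: each connected component has a chosen
terminal object. -/
structure LocalTerminals (C : Type u) [Category.{v} C] where
  /-- the chosen object of a connected component -/
  term : CategoryTheory.ConnectedComponents C → C
  term_mem : ∀ c, CategoryTheory.ConnectedComponents.mk (term c) = c
  /-- the map `τ_X` from `X` to the chosen object `uX` of its component -/
  τ : ∀ X : C, X ⟶ term (CategoryTheory.ConnectedComponents.mk X)
  τ_uniq : ∀ (X : C) (f : X ⟶ term (CategoryTheory.ConnectedComponents.mk X)), f = τ X

/-- The chosen terminal object `uX` in the connected component of `X`. -/
abbrev LocalTerminals.u {C : Type u} [Category.{v} C] (t : LocalTerminals C) (X : C) : C :=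
  t.term (CategoryTheory.ConnectedComponents.mk X)

/-- The data of an operadic category, without the axioms. -/
structure OperadicData (C : Type u) [Category.{v} C] extends LocalTerminals C where
  /-- the cardinality functor `|-|` -/
  card : C ⥤ FinOrdinal
  /-- the fibre functors `C / X ⥤ C`, for `i ∈ |X|` -/
  fibreFunctor : ∀ (X : C), Fin (card.obj X).n → (Over X ⥤ C)

namespace OperadicData

variable {C : Type u} [Category.{v} C] (S : OperadicData C)

/-- The fibre `f⁻¹(i)`. -/
def fibre {Y X : C} (f : Y ⟶ X) (i : Fin (S.card.obj X).n) : C :=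
  (S.fibreFunctor X i).obj (Over.mk f)

/-- The fibre map `(fg)⁻¹(i) ⟶ f⁻¹(i)` of `g` with respect to `f` at `i`. -/
def fibreMap {Z Y X : C} (g : Z ⟶ Y) (f : Y ⟶ X) (i : Fin (S.card.obj X).n) :
    S.fibre (g ≫ f) i ⟶ S.fibre f i :=
  (S.fibreFunctor X i).map (Over.homMk g : Over.mk (g ≫ f) ⟶ Over.mk f)

end OperadicData

/-- The axioms of an operadic category. Equalities of morphisms whose domains and codomains are
only propositionally equal are written with heterogeneous equality. -/
structure OperadicData.IsOperadic {C : Type u} [Category.{v} C] (S : OperadicData C) : Prop where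
  /-- local terminals have cardinality `1` -/
  card_term : ∀ c, S.card.obj (S.term c) = FinOrdinal.one
  /-- fibres of identities are chosen terminals -/
  fibre_id : ∀ (X : C) (i : Fin (S.card.obj X).n), ∃ c, S.fibre (𝟙 X) i = S.term c
  /-- `|f⁻¹(i)| = |f|⁻¹(i)` -/
  card_fibre : ∀ {Y X : C} (f : Y ⟶ X) (i : Fin (S.card.obj X).n),
    S.card.obj (S.fibre f i) = FinOrdinal.fibre (S.card.map f) i
  /-- the cardinality of a fibre map is the fibre map of the cardinalities -/
  card_fibreMap : ∀ {Z Y X : C} (g : Z ⟶ Y) (f : Y ⟶ X) (i : Fin (S.card.obj X).n),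
    S.card.map (S.fibreMap g f i) ≍ FinOrdinal.fibreMap (S.card.map g) (S.card.map f) i
  /-- `τ_X⁻¹(*) = X`, where `*` is the only element of `|uX| = 1` -/
  fibre_τ : ∀ (X : C) (i : Fin (S.card.obj (S.u X)).n), S.fibre (S.τ X) i = X
  /-- the fibre map of `f : Y ⟶ X` with respect to `τ_X` at `*` is `f` -/
  fibreMap_τ : ∀ {Y X : C} (f : Y ⟶ X) (i : Fin (S.card.obj (S.u X)).n),
    S.fibreMap f (S.τ X) i ≍ f
  /-- the fibres of the fibre maps of `f` are fibres: for `j ∈ |f|⁻¹(i) = |f⁻¹(i)|`, the fibre at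
  `j` of the fibre map of `g` with respect to `f` at `i` is `g⁻¹(εj)` -/
  fibre_fibreMap : ∀ {Z Y X : C} (g : Z ⟶ Y) (f : Y ⟶ X) (i : Fin (S.card.obj X).n)
    (j : Fin (FinOrdinal.fibre (S.card.map f) i).n),
    S.fibre (S.fibreMap g f i) (Fin.cast (congrArg FinOrdinal.n (card_fibre f i).symm) j) =
      S.fibre g (FinOrdinal.fibreIncl (S.card.map f) i j)
  /-- the fibre maps of the fibre maps of `f` are fibre maps -/
  fibreMap_fibreMap : ∀ {W Z Y X : C} (h : W ⟶ Z) (g : Z ⟶ Y) (f : Y ⟶ X)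
    (i : Fin (S.card.obj X).n) (j : Fin (FinOrdinal.fibre (S.card.map f) i).n),
    S.fibreMap (S.fibreMap h (g ≫ f) i) (S.fibreMap g f i)
        (Fin.cast (congrArg FinOrdinal.n (card_fibre f i).symm) j) ≍
      S.fibreMap h g (FinOrdinal.fibreIncl (S.card.map f) i j)

/-- A small operadic category. -/
structure OpCat : Type (u + 1) where
  /-- the set of objects -/
  carrier : Type u
  [cat : SmallCategory carrier]
  /-- the local terminals, the cardinality functor and the fibre functors -/
  str : OperadicData carrier
  isOperadic : str.IsOperadic

namespace OpCat

instance (A : OpCat.{u}) : SmallCategory A.carrier := A.cat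

/-- `F` is an operadic functor: it strictly preserves local terminal objects, strictly commutes
with the cardinality functors, and preserves fibres and fibre maps. -/
structure IsOperadicFunctor {A B : OpCat.{u}} (F : A.carrier ⥤ B.carrier) : Prop where
  map_u : ∀ X, F.obj (A.str.u X) = B.str.u (F.obj X)
  comp_card : F ⋙ B.str.card = A.str.card
  map_fibre : ∀ {Y X : A.carrier} (f : Y ⟶ X) (i : Fin (A.str.card.obj X).n),
    F.obj (A.str.fibre f i) = B.str.fibre (F.map f)
      (Fin.cast (congrArg (fun G : A.carrier ⥤ FinOrdinal => (G.obj X).n) comp_card.symm) i)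
  map_fibreMap : ∀ {Z Y X : A.carrier} (g : Z ⟶ Y) (f : Y ⟶ X) (i : Fin (A.str.card.obj X).n),
    F.map (A.str.fibreMap g f i) ≍ B.str.fibreMap (F.map g) (F.map f)
      (Fin.cast (congrArg (fun G : A.carrier ⥤ FinOrdinal => (G.obj X).n) comp_card.symm) i)

theorem IsOperadicFunctor.id (A : OpCat.{u}) : IsOperadicFunctor (A := A) (B := A) (𝟭 _) where
  map_u _ := rfl
  comp_card := rfl
  map_fibre _ _ := rfl
  map_fibreMap _ _ _ := HEq.rfl

theorem map_heq {C D : Type*} [Category* C] [Category* D] (G : C ⥤ D)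
    {X X' Y Y' : C} {f : X ⟶ Y} {f' : X' ⟶ Y'} (hX : X = X') (hY : Y = Y') (h : f ≍ f') :
    G.map f ≍ G.map f' := by
  subst hX hY
  cases h
  rfl

theorem IsOperadicFunctor.comp {A B D : OpCat.{u}} {F : A.carrier ⥤ B.carrier}
    {G : B.carrier ⥤ D.carrier} (hF : IsOperadicFunctor F) (hG : IsOperadicFunctor G) :
    IsOperadicFunctor (F ⋙ G) where
  map_u X := (congrArg G.obj (hF.map_u X)).trans (hG.map_u _)
  comp_card := by rw [Functor.assoc, hG.comp_card, hF.comp_card]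
  map_fibre f i := (congrArg G.obj (hF.map_fibre f i)).trans (hG.map_fibre _ _)
  map_fibreMap g f i := by
    refine HEq.trans (map_heq G ?_ (hF.map_fibre f i) (hF.map_fibreMap g f i))
      (hG.map_fibreMap _ _ _)
    rw [← F.map_comp]
    exact hF.map_fibre (g ≫ f) i

/-- Operadic functors. -/
@[ext]
structure Hom (A B : OpCat.{u}) where
  /-- the underlying functor -/
  functor : A.carrier ⥤ B.carrier
  isOperadicFunctor : IsOperadicFunctor functor

/-- The category of small operadic categories and operadic functors. -/
instance : Category OpCat.{u} where
  Hom := Hom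
  id A := ⟨𝟭 _, .id A⟩
  comp f g := ⟨f.functor ⋙ g.functor, f.isOperadicFunctor.comp g.isOperadicFunctor⟩

/-- The underlying category of an operadic category. -/
def forget : OpCat.{u} ⥤ Cat.{u, u} where
  obj A := Cat.of A.carrier
  map f := f.functor.toCatHom

/-- An operadic category is unary if every object has cardinality `1`. -/
def isUnary : ObjectProperty OpCat.{u} := fun A => ∀ X, A.str.card.obj X = FinOrdinal.one

end OpCat

/-- The category of small unary operadic categories and operadic functors. -/
abbrev UnaryOpCat : Type (u + 1) := OpCat.isUnary.{u}.FullSubcategory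

/-! ### Décalage -/

/-- The map `n + 1 → m + 1` obtained from a monotone map `f : n → m` of finite ordinals by adding
a top element to both sides. -/
def addTopHom {n m : ℕ} (f : Fin n →o Fin m) : Fin (n + 1) →o Fin (m + 1) where
  toFun := Fin.lastCases (Fin.last m) fun i => (f i).castSucc
  monotone' := by
    intro i j hij
    induction j using Fin.lastCases with
    | last => simpa using Fin.le_last _
    | cast j =>
      induction i using Fin.lastCases with
      | last => exact absurd hij (not_le.2 (Fin.castSucc_lt_last j))
      | cast i => simpa using f.monotone (Fin.castSucc_le_castSucc_iff.1 hij)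

theorem addTopHom_last {n m : ℕ} (f : Fin n →o Fin m) :
    addTopHom f (Fin.last n) = Fin.last m :=
  Fin.lastCases_last (motive := fun _ => Fin (m + 1))

theorem addTopHom_castSucc {n m : ℕ} (f : Fin n →o Fin m) (i : Fin n) :
    addTopHom f i.castSucc = (f i).castSucc :=
  Fin.lastCases_castSucc (motive := fun _ => Fin (m + 1)) i

theorem addTopHom_comp {l n m : ℕ} (g : Fin n →o Fin m) (f : Fin l →o Fin n) :
    addTopHom (g.comp f) = (addTopHom g).comp (addTopHom f) := by
  ext i : 2
  induction i using Fin.lastCases <;>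
    simp only [OrderHom.comp_coe, Function.comp_apply, addTopHom_last, addTopHom_castSucc]

/-- The functor `T : Δ ⥤ Δ`, `[n] ↦ [n + 1]`, that freely adjoins a top element. -/
def addTop : SimplexCategory ⥤ SimplexCategory where
  obj a := SimplexCategory.mk (a.len + 1)
  map f := SimplexCategory.Hom.mk (addTopHom f.toOrderHom)
  map_id a := by
    ext i : 3
    induction i using Fin.lastCases <;> simp [addTopHom]
  map_comp f g := by
    rw [SimplexCategory.comp_toOrderHom, addTopHom_comp]
    rfl

/-- The (upper) décalage `D` of simplicial sets: precomposition with `T`. -/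
def dec : SSet.{u} ⥤ SSet.{u} :=
  (Functor.whiskeringLeft _ _ (Type u)).obj addTop.op

/-- The simplicial sets `C` for which `D(C)` satisfies the Segal condition. -/
def isDecSegal : ObjectProperty SSet.{u} := fun C => (dec.obj C).IsStrictSegal

end Operadic

/-! An `n`-simplex of the nerve of a unary operadic category `𝒞` is a chain of `n` morphisms that
ends in a chosen terminal object; the top face drops that object and applies the fibre functor over
the object that is now last, and the axioms of an operadic category are the simplicial identities.
Since the last object of a simplex is forced by the others, forgetting it identifies the décalage
with the nerve of `𝒞`. Conversely, if `D(K)` satisfies the Segal condition, it is the nerve of a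
category. The top degeneracies of `K` then single out one terminal object in each component, and
the top faces act on chains over `X` as a functor `𝒞/X ⥤ 𝒞`.

Reflectivity holds because the Segal condition on `D(K)` says that `K` is orthogonal to a set of
maps between finitely presentable simplicial sets. -/

namespace Operadic

section Pushout

variable {C : Type*} [Category* C] {A B D E : C} {p : A ⟶ B} {q : A ⟶ D} {r : B ⟶ E} {s : D ⟶ E}

theorem bijective_pushoutDesc_comp_iff [Limits.HasPushout p q] (w : p ≫ r = q ≫ s) (K : C) :
    Function.Bijective (fun k : E ⟶ K => Limits.pushout.desc r s w ≫ k) ↔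
      ∀ (f : B ⟶ K) (g : D ⟶ K), p ≫ f = q ≫ g → ∃! k : E ⟶ K, r ≫ k = f ∧ s ≫ k = g := by
  have desc_comp_eq_iff (k : E ⟶ K) (l : Limits.pushout p q ⟶ K) :
      Limits.pushout.desc r s w ≫ k = l ↔
        r ≫ k = Limits.pushout.inl p q ≫ l ∧ s ≫ k = Limits.pushout.inr p q ≫ l := by
    rw [Limits.pushout.hom_ext_iff, Limits.pushout.inl_desc_assoc, Limits.pushout.inr_desc_assoc]
  simp only [Function.bijective_iff_existsUnique, desc_comp_eq_iff]
  refine ⟨fun h f g hfg => ?_, fun h l => h _ _ (Limits.pushout.condition_assoc _)⟩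
  simpa only [Limits.pushout.inl_desc, Limits.pushout.inr_desc] using
    h (Limits.pushout.desc f g hfg)

end Pushout

section Simplices

variable {X : SSet.{u}} {a b c : SimplexCategory} {m n : ℕ}

theorem map_map_of_eq (X : SSet.{u}) {f : a ⟶ b} {g : b ⟶ c} {h : a ⟶ c} (hfg : f ≫ g = h)
    (x : X.obj (op c)) : X.map f.op (X.map g.op x) = X.map h.op x := by
  subst hfg
  exact (ConcreteCategory.congr_hom (X.map_comp g.op f.op) x).symm

theorem map_of_eq_id (X : SSet.{u}) {f : a ⟶ a} (hf : f = 𝟙 a) (x : X.obj (op a)) :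
    X.map f.op x = x := by
  subst hf
  exact ConcreteCategory.congr_hom (X.map_id (op a)) x

/-- The `i`-th vertex of a simplex. -/
def vertex (x : X.obj (op (.mk n))) (i : Fin (n + 1)) : X.obj (op (.mk 0)) :=
  X.map (SimplexCategory.const (.mk 0) (.mk n) i).op x

theorem vertex_map (f : SimplexCategory.mk m ⟶ SimplexCategory.mk n) (x : X.obj (op (.mk n)))
    (i : Fin (m + 1)) : vertex (X.map f.op x) i = vertex x (f.toOrderHom i) :=
  map_map_of_eq X rfl x

/-- The edge of a simplex from its `i`-th to its `j`-th vertex. -/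
def edgeOfLE (x : X.obj (op (.mk n))) {i j : Fin (n + 1)} (h : i ≤ j) :
    SSet.Edge (vertex x i) (vertex x j) :=
  .mk (X.map (SimplexCategory.mkOfLe i j h).op x)
    (map_map_of_eq X (by exact SimplexCategory.Hom.ext_zero_left _ _) x)
    (map_map_of_eq X (by exact SimplexCategory.Hom.ext_zero_left _ _) x)

theorem edgeOfLE_map_edge (f : SimplexCategory.mk m ⟶ SimplexCategory.mk n)
    (x : X.obj (op (.mk n))) {i j : Fin (m + 1)} (h : i ≤ j) :
    (edgeOfLE (X.map f.op x) h).edge = (edgeOfLE x (f.toOrderHom.monotone h)).edge :=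
  map_map_of_eq X (by exact SimplexCategory.Hom.ext_one_left _ _) x

theorem edgeOfLE_zero_one_edge (x : X.obj (op (.mk 1))) :
    (edgeOfLE x (Fin.zero_le (1 : Fin 2))).edge = x :=
  map_of_eq_id X (by exact SimplexCategory.Hom.ext_one_left _ _) x

theorem edgeOfLE_self (x : X.obj (op (.mk n))) (i : Fin (n + 1)) :
    edgeOfLE x (le_refl i) = .id (vertex x i) :=
  SSet.Edge.ext (map_map_of_eq X (by exact SimplexCategory.Hom.ext_one_left _ _) x).symm

/-- The triangle of a simplex on its vertices `i ≤ j ≤ k` exhibits the edge from `i` to `k` as a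
composite. -/
def compStructOfLE (x : X.obj (op (.mk n))) {i j k : Fin (n + 1)} (hij : i ≤ j) (hjk : j ≤ k) :
    SSet.Edge.CompStruct (edgeOfLE x hij) (edgeOfLE x hjk) (edgeOfLE x (hij.trans hjk)) :=
  .mk (X.map (SimplexCategory.mkOfLeComp i j k hij hjk).op x)
    (map_map_of_eq X (by exact SimplexCategory.Hom.ext_one_left _ _) x)
    (map_map_of_eq X (by exact SimplexCategory.Hom.ext_one_left _ _) x)
    (map_map_of_eq X (by exact SimplexCategory.Hom.ext_one_left _ _) x)

end Simplices

section StrictSegal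

variable {X : SSet.{u}} [X.IsStrictSegal] {n : ℕ}

theorem simplex_ext {x y : X.obj (op (.mk n))} (hv : ∀ i, vertex x i = vertex y i)
    (he : ∀ i : Fin n, (edgeOfLE x (Fin.castSucc_le_succ i)).edge =
      (edgeOfLE y (Fin.castSucc_le_succ i)).edge) : x = y :=
  (SSet.IsStrictSegal.segal n).1 (SSet.Path.ext (funext hv) (funext he))

theorem simplex_ext_of_δ_zero {x y : X.obj (op (.mk (n + 1)))}
    (hδ : X.map (SimplexCategory.δ 0).op x = X.map (SimplexCategory.δ 0).op y)
    (he : X.map (SimplexCategory.mkOfSucc 0).op x = X.map (SimplexCategory.mkOfSucc 0).op y) :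
    x = y := by
  refine simplex_ext (fun i => ?_) (fun i => ?_)
  · cases i using Fin.cases with
    | zero =>
      have h := congrArg (vertex · 0) he
      exact (vertex_map _ x 0).symm.trans (h.trans (vertex_map _ y 0))
    | succ i =>
      have h := congrArg (vertex · i) hδ
      exact (vertex_map _ x i).symm.trans (h.trans (vertex_map _ y i))
  · cases i using Fin.cases with
    | zero => exact he
    | succ i =>
      have h := congrArg (fun z => (edgeOfLE z (Fin.castSucc_le_succ i)).edge) hδ
      exact (edgeOfLE_map_edge _ x _).symm.trans (h.trans (edgeOfLE_map_edge _ y _))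

theorem exists_simplex (v : Fin (n + 1) → X.obj (op (.mk 0)))
    (f : ∀ i : Fin n, SSet.Edge (v i.castSucc) (v i.succ)) :
    ∃ x : X.obj (op (.mk n)), (∀ i, vertex x i = v i) ∧
      ∀ i : Fin n, (edgeOfLE x (Fin.castSucc_le_succ i)).edge = (f i).edge := by
  obtain ⟨x, hx⟩ := (SSet.IsStrictSegal.segal (X := X) n).2
    { vertex := v
      arrow i := (f i).edge
      arrow_src i := (f i).src_eq
      arrow_tgt i := (f i).tgt_eq }
  exact ⟨x, SSet.Path.congr_vertex hx, SSet.Path.congr_arrow hx⟩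

variable {x y z w : X.obj (op (.mk 0))}

theorem exists_compStruct (f : SSet.Edge x y) (g : SSet.Edge y z) :
    ∃ h : SSet.Edge x z, Nonempty (SSet.Edge.CompStruct f g h) := by
  obtain ⟨s, hv, he⟩ := exists_simplex (n := 2) ![x, y, z] fun | 0 => f | 1 => g
  exact ⟨(edgeOfLE s (Fin.zero_le 2)).ofEq (hv 0) (hv 2),
    ⟨(compStructOfLE s (Fin.zero_le 1) (Fin.castSucc_le_succ 1)).ofEq (he 0) (he 1) rfl⟩⟩

theorem compStruct_unique {f : SSet.Edge x y} {g : SSet.Edge y z} {h h' : SSet.Edge x z}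
    (c : SSet.Edge.CompStruct f g h) (c' : SSet.Edge.CompStruct f g h') : h = h' := by
  have first_edge : SimplexCategory.δ (2 : Fin 3) = SimplexCategory.mkOfSucc 0 :=
    SimplexCategory.Hom.ext_one_left _ _
  have hc : c.simplex = c'.simplex := simplex_ext_of_δ_zero (c.d₀.trans c'.d₀.symm)
    (first_edge ▸ c.d₂.trans c'.d₂.symm)
  exact SSet.Edge.ext (c.d₁.symm.trans ((congrArg (X.δ 1) hc).trans c'.d₁))

/-- The composite of two edges of a simplicial set that satisfies the Segal condition. -/
noncomputable def edgeComp (f : SSet.Edge x y) (g : SSet.Edge y z) : SSet.Edge x z :=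
  (exists_compStruct f g).choose

theorem edgeComp_eq {f : SSet.Edge x y} {g : SSet.Edge y z} {h : SSet.Edge x z}
    (c : SSet.Edge.CompStruct f g h) : edgeComp f g = h :=
  compStruct_unique (exists_compStruct f g).choose_spec.some c

theorem edgeComp_edgeOfLE (s : X.obj (op (.mk n))) {i j k : Fin (n + 1)} (hij : i ≤ j)
    (hjk : j ≤ k) :
    edgeComp (edgeOfLE s hij) (edgeOfLE s hjk) = edgeOfLE s (hij.trans hjk) :=
  edgeComp_eq (compStructOfLE s hij hjk)

theorem edgeComp_assoc (f : SSet.Edge x y) (g : SSet.Edge y z) (h : SSet.Edge z w) :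
    edgeComp (edgeComp f g) h = edgeComp f (edgeComp g h) := by
  obtain ⟨s, hv, he⟩ := exists_simplex (n := 3) ![x, y, z, w] fun | 0 => f | 1 => g | 2 => h
  obtain rfl : vertex s 0 = x := hv 0
  obtain rfl : vertex s 1 = y := hv 1
  obtain rfl : vertex s 2 = z := hv 2
  obtain rfl : vertex s 3 = w := hv 3
  obtain rfl := SSet.Edge.ext (he 0)
  obtain rfl := SSet.Edge.ext (he 1)
  obtain rfl := SSet.Edge.ext (he 2)
  simp only [edgeComp_edgeOfLE]

variable (X) in
/-- The vertices of a simplicial set that satisfies the Segal condition, as the objects of the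
category whose morphisms are the edges. -/
structure EdgeCategory where
  /-- The underlying vertex. -/
  vertex : X.obj (op (.mk 0))

noncomputable instance : SmallCategory (EdgeCategory X) where
  Hom x y := SSet.Edge x.vertex y.vertex
  id x := .id x.vertex
  comp f g := edgeComp f g
  id_comp f := edgeComp_eq (.idComp f)
  comp_id f := edgeComp_eq (.compId f)
  assoc f g h := edgeComp_assoc f g h

theorem EdgeCategory.hom_heq_iff {x y x' y' : EdgeCategory X} (hx : x = x') (hy : y = y')
    (f : x ⟶ y) (g : x' ⟶ y') : f ≍ g ↔ SSet.Edge.edge f = SSet.Edge.edge g := by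
  subst hx hy
  exact heq_iff_eq.trans SSet.Edge.ext_iff

/-- The chain of the vertices of a simplex in the category of edges. -/
noncomputable def edgeChain (x : X.obj (op (.mk n))) : ComposableArrows (EdgeCategory X) n where
  obj i := ⟨vertex x i⟩
  map f := edgeOfLE x (leOfHom f)
  map_id i := edgeOfLE_self x i
  map_comp f g := (edgeComp_edgeOfLE x (leOfHom f) (leOfHom g)).symm

theorem edgeChain_injective : Function.Injective (edgeChain (X := X) (n := n)) := by
  intro x y h
  have ho (i : Fin (n + 1)) : (edgeChain x).obj i = (edgeChain y).obj i := Functor.congr_obj h i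
  exact simplex_ext (fun i => congrArg EdgeCategory.vertex (ho i)) fun i =>
    (EdgeCategory.hom_heq_iff (ho _) (ho _) _ _).1
      (Functor.hcongr_hom h (homOfLE (Fin.castSucc_le_succ i)))

theorem edgeChain_surjective : Function.Surjective (edgeChain (X := X) (n := n)) := by
  intro F
  obtain ⟨x, hv, he⟩ := exists_simplex (fun i => (F.obj i).vertex)
    fun i => F.map (homOfLE (Fin.castSucc_le_succ i))
  have ho (i : Fin (n + 1)) : (edgeChain x).obj i = F.obj i := congrArg EdgeCategory.mk (hv i)
  exact ⟨x, ComposableArrows.ext ho fun i hi => (conj_eqToHom_iff_heq _ _ (ho _) (ho _)).2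
    ((EdgeCategory.hom_heq_iff (ho _) (ho _) _ _).2 (he ⟨i, hi⟩))⟩

variable (X) in
/-- The comparison of a simplicial set that satisfies the Segal condition with the nerve of its
category of edges. -/
noncomputable def toNerveEdgeCategory : X ⟶ nerve (EdgeCategory X) where
  app Δ := ↾fun x => edgeChain x
  naturality _ Δ f := by
    refine ConcreteCategory.hom_ext _ _ fun x => ?_
    have ho (i : Fin (Δ.unop.len + 1)) :
        EdgeCategory.mk (vertex (X.map f x) i) = ⟨vertex x (f.unop.toOrderHom i)⟩ :=
      congrArg EdgeCategory.mk (vertex_map f.unop x i)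
    exact Functor.hext ho fun i j g => (EdgeCategory.hom_heq_iff (ho i) (ho j) _ _).2
      (edgeOfLE_map_edge f.unop x (leOfHom g))

instance : IsIso (toNerveEdgeCategory X) := by
  rw [NatTrans.isIso_iff_isIso_app]
  exact fun Δ => (isIso_iff_bijective _).2 ⟨edgeChain_injective, edgeChain_surjective⟩

end StrictSegal

section Locality

theorem existsUnique_concat (X : SSet.{u}) [X.IsStrictSegal] (n : ℕ) (s : X.obj (op (.mk n)))
    (f : X.obj (op (.mk 1)))
    (h : X.map (SimplexCategory.const (.mk 0) (.mk n) 0).op s =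
      X.map (SimplexCategory.const (.mk 0) (.mk 1) 1).op f) :
    ∃! x : X.obj (op (.mk (n + 1))), X.map (SimplexCategory.δ 0).op x = s ∧
      X.map (SimplexCategory.mkOfSucc 0).op x = f := by
  let v : Fin (n + 2) → X.obj (op (.mk 0)) := Fin.cons (vertex f 0) (vertex s)
  let a (i : Fin (n + 1)) : SSet.Edge (v i.castSucc) (v i.succ) :=
    Fin.cases ((edgeOfLE f (Fin.zero_le (1 : Fin 2))).ofEq rfl h.symm)
      (fun i => edgeOfLE s (Fin.castSucc_le_succ i)) i
  obtain ⟨x, hv, he⟩ := exists_simplex v a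
  have hs : X.map (SimplexCategory.δ 0).op x = s := simplex_ext
    (fun i => (vertex_map _ x i).trans (hv i.succ))
    (fun i => (edgeOfLE_map_edge _ x _).trans (he i.succ))
  have hf : X.map (SimplexCategory.mkOfSucc 0).op x = f :=
    (he 0).trans (edgeOfLE_zero_one_edge f)
  exact ⟨x, ⟨hs, hf⟩, fun y hy =>
    simplex_ext_of_δ_zero (hy.1.trans hs.symm) (hy.2.trans hf.symm)⟩

theorem δ_zero_comp (n : ℕ) :
    SimplexCategory.const (.mk 0) (.mk n) 0 ≫ SimplexCategory.δ (0 : Fin (n + 2)) =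
      SimplexCategory.const (.mk 0) (.mk 1) 1 ≫ SimplexCategory.mkOfSucc (0 : Fin (n + 1)) :=
  SimplexCategory.Hom.ext_zero_left _ _

theorem isStrictSegal_iff (X : SSet.{u}) :
    X.IsStrictSegal ↔ ∀ (n : ℕ) (s : X.obj (op (.mk n))) (f : X.obj (op (.mk 1))),
      X.map (SimplexCategory.const (.mk 0) (.mk n) 0).op s =
        X.map (SimplexCategory.const (.mk 0) (.mk 1) 1).op f →
      ∃! x : X.obj (op (.mk (n + 1))), X.map (SimplexCategory.δ 0).op x = s ∧
        X.map (SimplexCategory.mkOfSucc 0).op x = f := by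
  refine ⟨fun _ => existsUnique_concat X, fun h => ?_⟩
  have composable {n : ℕ} {f : X.obj (op (.mk 1))} {s : X.obj (op (.mk n))}
      (hs : X.δ 0 f = X.map (SimplexCategory.const (.mk 0) (.mk n) 0).op s) :
      X.map (SimplexCategory.const (.mk 0) (.mk n) 0).op s =
        X.map (SimplexCategory.const (.mk 0) (.mk 1) 1).op f := by
    rw [← hs, ← SimplexCategory.δ_zero_eq_const]
    rfl
  exact (SSet.StrictSegal.ofCore fun n =>
    { concat f s hs := (h n s f (composable hs)).choose
      map_mkOfSucc_zero_concat f s hs := (h n s f (composable hs)).choose_spec.1.2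
      δ₀_concat f s hs := (h n s f (composable hs)).choose_spec.1.1
      injective {x y} hf hs := (h n (X.δ 0 y) (X.map (SimplexCategory.mkOfSucc 0).op y)
        ((map_map_of_eq X (δ_zero_comp n) y).trans (map_map_of_eq X rfl y).symm)).unique
          ⟨hs, hf⟩ ⟨rfl, rfl⟩ }).isStrictSegal

variable (T : SimplexCategory ⥤ SimplexCategory)

/-- The maps of simplicial sets that detect the Segal condition on a simplicial set precomposed
with `T`: the inclusion of the union of the initial edge and the opposite face into a standard
simplex, transformed by `T`. -/
def segalMaps : MorphismProperty SSet.{u} :=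
  MorphismProperty.ofHoms fun n : ℕ =>
    Limits.pushout.desc
      (f := (T ⋙ SSet.stdSimplex.{u}).map (SimplexCategory.const (.mk 0) (.mk n) 0))
      (g := (T ⋙ SSet.stdSimplex.{u}).map (SimplexCategory.const (.mk 0) (.mk 1) 1))
      ((T ⋙ SSet.stdSimplex.{u}).map (SimplexCategory.δ (0 : Fin (n + 2))))
      ((T ⋙ SSet.stdSimplex.{u}).map (SimplexCategory.mkOfSucc (0 : Fin (n + 1))))
      (by rw [← Functor.map_comp, ← Functor.map_comp, δ_zero_comp])

theorem isLocal_segalMaps_iff (X : SSet.{u}) :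
    (segalMaps T).isLocal X ↔
      SSet.IsStrictSegal (((Functor.whiskeringLeft _ _ (Type u)).obj T.op).obj X) := by
  rw [isStrictSegal_iff]
  refine Iff.trans (b := ∀ n : ℕ, _) ⟨fun h n => h _ ⟨n⟩, fun h => ?_⟩ (forall_congr' fun n => ?_)
  · rintro _ _ _ ⟨n⟩
    exact h n
  · refine (bijective_pushoutDesc_comp_iff _ X).trans ?_
    refine SSet.yonedaEquiv.forall_congr fun s => SSet.yonedaEquiv.forall_congr fun f => ?_
    refine imp_congr ?_ (SSet.yonedaEquiv.existsUnique_congr fun x => ?_)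
    · change _ ↔ X.map (T.map _).op _ = X.map (T.map _).op _
      rw [SSet.yonedaEquiv_naturality, SSet.yonedaEquiv_naturality, EmbeddingLike.apply_eq_iff_eq]
      rfl
    · change _ ↔ X.map (T.map _).op _ = _ ∧ X.map (T.map _).op _ = _
      rw [SSet.yonedaEquiv_naturality, SSet.yonedaEquiv_naturality, EmbeddingLike.apply_eq_iff_eq,
        EmbeddingLike.apply_eq_iff_eq]
      rfl

theorem isStrictSegal_of_iso {X Y : SSet.{u}} (i : X ≅ Y) (hX : X.IsStrictSegal) :
    Y.IsStrictSegal :=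
  (isLocal_segalMaps_iff (𝟭 _) Y).1
    (ObjectProperty.prop_of_iso _ i ((isLocal_segalMaps_iff (𝟭 _) X).2 hX))

theorem isRightAdjoint_ι_isLocal_segalMaps :
    (segalMaps.{u} T).isLocal.ι.IsRightAdjoint := by
  have := Cardinal.fact_isRegular_aleph0.{u}
  have : MorphismProperty.IsSmall.{u} (segalMaps.{u} T) :=
    MorphismProperty.isSmall_ofHoms.{u} _
  refine (segalMaps.{u} T).isRightAdjoint_ι_isLocal Cardinal.aleph0.{u} ?_
  have presentable (a : SimplexCategory) :
      IsCardinalPresentable ((T ⋙ SSet.stdSimplex.{u}).obj a) Cardinal.aleph0.{u} :=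
    inferInstanceAs (IsCardinalPresentable (SSet.stdSimplex.obj (T.obj a)) _)
  rintro _ _ _ ⟨n⟩
  have presentable_span (k : Limits.WalkingSpan) : IsCardinalPresentable
      ((Limits.span
        ((T ⋙ SSet.stdSimplex.{u}).map (SimplexCategory.const (.mk 0) (.mk n) 0))
        ((T ⋙ SSet.stdSimplex.{u}).map (SimplexCategory.const (.mk 0) (.mk 1) 1))).obj k)
      Cardinal.aleph0.{u} := by
    rcases k with _ | _ | _ <;> exact presentable _
  exact ⟨isCardinalPresentable_of_isColimit' _ (Limits.colimit.isColimit _) _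
    (hasCardinalLT_of_finite _ _ le_rfl), presentable _⟩

theorem nonempty_reflective_isDecSegal : Nonempty (Reflective isDecSegal.{u}.ι) := by
  have isDecSegal_eq : isDecSegal.{u} = (segalMaps addTop).isLocal :=
    funext fun K => propext (isLocal_segalMaps_iff addTop K).symm
  rw [isDecSegal_eq]
  have := isRightAdjoint_ι_isLocal_segalMaps.{u} addTop
  exact ⟨⟨_, Adjunction.ofIsRightAdjoint _⟩⟩

end Locality

section Chains

variable {C : Type u} [Category.{v} C]

theorem thin_hom_heq {P : Type*} [Category* P] [Quiver.IsThin P] {a a' b b' : P} (ha : a = a')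
    (hb : b = b') (f : a ⟶ b) (g : a' ⟶ b') : f ≍ g := by
  subst ha hb
  exact heq_of_eq (Subsingleton.elim _ _)

theorem map_homMk_heq {X Y Z : C} (F : Over X ⥤ C) {a a' : Z ⟶ X} (h : a = a') {b : Y ⟶ X}
    {k : Z ⟶ Y} (hk : k ≫ b = a) (hk' : k ≫ b = a') :
    F.map (Over.homMk k hk : Over.mk a ⟶ Over.mk b) ≍
      F.map (Over.homMk k hk' : Over.mk a' ⟶ Over.mk b) := by
  subst h
  rfl

/-- The restriction of a chain `F` along `a`, as a chain of objects over the object at `b`. -/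
@[simps]
def overRestrict {m n : ℕ} (F : Fin n ⥤ C) (a : Fin m →o Fin n) (b : Fin n) (h : ∀ i, a i ≤ b) :
    Fin m ⥤ Over (F.obj b) where
  obj i := Over.mk (F.map (homOfLE (h i)))
  map f := Over.homMk (F.map (homOfLE (a.monotone (leOfHom f)))) (by simp [← F.map_comp])
  map_id i := by ext; exact F.map_id _
  map_comp f g := by ext; simp [← F.map_comp]

/-- The inclusion of `Fin n` into `Fin (n + 1)` as an initial segment. -/
abbrev castSuccHom (n : ℕ) : Fin n →o Fin (n + 1) :=
  Fin.castSuccOrderEmb.toOrderHom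

theorem addTopHom_comp_castSuccHom {m n : ℕ} (a : Fin m →o Fin n) :
    (addTopHom a).comp (castSuccHom m) = (castSuccHom n).comp a :=
  OrderHom.ext _ _ (funext (addTopHom_castSucc a))

instance {P : Type*} [Category* P] [Quiver.IsThin P] : Quiver.IsThin (WithTerminal P)
  | .of a, .of b => inferInstanceAs (Subsingleton (a ⟶ b))
  | .of _, .star => inferInstanceAs (Subsingleton PUnit)
  | .star, .star => inferInstanceAs (Subsingleton PUnit)
  | .star, .of _ => inferInstanceAs (Subsingleton PEmpty)

/-- The ordinal `n + 1` as the ordinal `n` with a terminal object added. -/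
noncomputable def finToWithTerminal (n : ℕ) : Fin (n + 1) ⥤ WithTerminal (Fin n) where
  obj := Fin.lastCases .star .of
  map {i j} f := Classical.choice (by
    induction j using Fin.lastCases with
    | last =>
      rw [Fin.lastCases_last]
      exact ⟨WithTerminal.starTerminal.from _⟩
    | cast j =>
      induction i using Fin.lastCases with
      | last => exact absurd (leOfHom f) (not_le.2 (Fin.castSucc_lt_last j))
      | cast i =>
        rw [Fin.lastCases_castSucc, Fin.lastCases_castSucc]
        exact ⟨WithTerminal.incl.map (homOfLE (Fin.castSucc_le_castSucc_iff.1 (leOfHom f)))⟩)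
  map_id _ := Subsingleton.elim _ _
  map_comp _ _ := Subsingleton.elim _ _

theorem finToWithTerminal_last (n : ℕ) : (finToWithTerminal n).obj (Fin.last n) = .star :=
  Fin.lastCases_last (motive := fun _ => WithTerminal (Fin n))

theorem finToWithTerminal_castSucc {n : ℕ} (i : Fin n) :
    (finToWithTerminal n).obj i.castSucc = .of i :=
  Fin.lastCases_castSucc (motive := fun _ => WithTerminal (Fin n)) i

theorem castSucc_comp_finToWithTerminal (n : ℕ) :
    (castSuccHom n).monotone.functor ⋙ finToWithTerminal n = WithTerminal.incl :=
  Functor.hext finToWithTerminal_castSucc fun i j _ =>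
    thin_hom_heq (finToWithTerminal_castSucc i) (finToWithTerminal_castSucc j) _ _

/-- A chain of objects over `X`, extended by `X`. -/
noncomputable def snoc {n : ℕ} {X : C} (H : Fin n ⥤ Over X) : Fin (n + 1) ⥤ C :=
  finToWithTerminal n ⋙ WithTerminal.lift (Z := X) (H ⋙ Over.forget X) (fun i => (H.obj i).hom)
    (fun _ _ f => Over.w (H.map f))

variable {n : ℕ}

theorem castSucc_comp_snoc {X : C} (H : Fin n ⥤ Over X) :
    (castSuccHom n).monotone.functor ⋙ snoc H = H ⋙ Over.forget X := by
  rw [snoc, ← Functor.assoc, castSucc_comp_finToWithTerminal]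
  rfl

theorem snoc_last {X : C} (H : Fin n ⥤ Over X) : (snoc H).obj (Fin.last n) = X := by
  rw [snoc, Functor.comp_obj, finToWithTerminal_last]
  rfl

theorem snoc_map_last {X : C} (H : Fin n ⥤ Over X) (i : Fin n) :
    (snoc H).map (homOfLE (Fin.le_last i.castSucc)) ≍ (H.obj i).hom :=
  OpCat.map_heq (WithTerminal.lift (Z := X) (H ⋙ Over.forget X) (fun i => (H.obj i).hom)
    (fun _ _ f => Over.w (H.map f))) (finToWithTerminal_castSucc i) (finToWithTerminal_last n)
    (thin_hom_heq (finToWithTerminal_castSucc i) (finToWithTerminal_last n) _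
      (WithTerminal.homFrom i))

theorem chain_ext {F G : Fin (n + 1) ⥤ C}
    (h : (castSuccHom n).monotone.functor ⋙ F = (castSuccHom n).monotone.functor ⋙ G)
    (hl : F.obj (Fin.last n) = G.obj (Fin.last n))
    (hm : ∀ i : Fin n, F.map (homOfLE (Fin.le_last i.castSucc)) ≍
      G.map (homOfLE (Fin.le_last i.castSucc))) : F = G := by
  have hobj : ∀ i, F.obj i = G.obj i := Fin.lastCases hl (Functor.congr_obj h)
  suffices hmap : ∀ i j (hij : i ≤ j), F.map (homOfLE hij) ≍ G.map (homOfLE hij) from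
    Functor.hext hobj fun i j f => hmap i j (leOfHom f)
  intro i j hij
  induction j using Fin.lastCases with
  | last =>
    induction i using Fin.lastCases with
    | last =>
      change F.map (𝟙 _) ≍ G.map (𝟙 _)
      rw [F.map_id, G.map_id, hl]
    | cast i => exact hm i
  | cast j =>
    induction i using Fin.lastCases with
    | last => exact absurd hij (not_le.2 (Fin.castSucc_lt_last j))
    | cast i => exact Functor.hcongr_hom h (homOfLE (Fin.castSucc_le_castSucc_iff.1 hij))

theorem chain_ext_of_unique_last {P : C → Prop}
    (hP : ∀ {X T T' : C}, P T → P T' → ∀ (f : X ⟶ T) (g : X ⟶ T'), T = T' ∧ f ≍ g)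
    {F G : Fin (n + 2) ⥤ C}
    (h : (castSuccHom (n + 1)).monotone.functor ⋙ F = (castSuccHom (n + 1)).monotone.functor ⋙ G)
    (hF : P (F.obj (Fin.last _))) (hG : P (G.obj (Fin.last _))) : F = G := by
  have hobj (i : Fin (n + 1)) : F.obj i.castSucc = G.obj i.castSucc := Functor.congr_obj h i
  have huniq {X X' T T' : C} (hX : X = X') (hT : P T) (hT' : P T') (f : X ⟶ T) (g : X' ⟶ T') :
      T = T' ∧ f ≍ g := by
    subst hX
    exact hP hT hT' f g
  exact chain_ext h (huniq (hobj 0) hF hG (F.map (homOfLE (Fin.le_last _)))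
    (G.map (homOfLE (Fin.le_last _)))).1 fun i => (huniq (hobj i) hF hG _ _).2

/-- The chain of the first objects of a chain, over its last object. -/
abbrev overLast (F : Fin (n + 1) ⥤ C) : Fin n ⥤ Over (F.obj (Fin.last n)) :=
  overRestrict F (castSuccHom n) (Fin.last n) (fun _ => Fin.le_last _)

theorem snoc_overLast (F : Fin (n + 1) ⥤ C) : snoc (overLast F) = F :=
  chain_ext (castSucc_comp_snoc _) (snoc_last _) (snoc_map_last _)

theorem snoc_comp {m : ℕ} {X : C} (H : Fin n ⥤ Over X) (a : Fin m →o Fin n) :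
    snoc (a.monotone.functor ⋙ H) = (addTopHom a).monotone.functor ⋙ snoc H := by
  have hl := addTopHom_last a
  have hc (i : Fin m) := addTopHom_castSucc a i
  refine chain_ext ?_ ?_ fun i => ?_
  · have h := congrArg (fun b : Fin m →o Fin (n + 1) => b.monotone.functor ⋙ snoc H)
      (addTopHom_comp_castSuccHom a)
    exact (castSucc_comp_snoc _).trans
      ((congrArg (a.monotone.functor ⋙ ·) (castSucc_comp_snoc H).symm).trans h.symm)
  · exact (snoc_last _).trans ((snoc_last H).symm.trans (congrArg (snoc H).obj hl.symm))
  · exact (snoc_map_last _ i).trans ((snoc_map_last H (a i)).symm.trans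
      (OpCat.map_heq _ (hc i).symm hl.symm (thin_hom_heq (hc i).symm hl.symm _ _)))

theorem comp_heq_of_heq_id {X Y Z T : C} (f : X ⟶ Y) (g : Y ⟶ Z) (hY : Y = T) (hZ : Z = T)
    (hg : g ≍ 𝟙 T) : f ≫ g ≍ f := by
  subst hY hZ
  obtain rfl := eq_of_heq hg
  rw [Category.comp_id]

end Chains

section TopFace

/-- The inclusion of `[n]` into `[n + 1]` as an initial segment. -/
abbrev topFace (n : ℕ) : SimplexCategory.mk n ⟶ SimplexCategory.mk (n + 1) :=
  SimplexCategory.Hom.mk (castSuccHom (n + 1))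

/-- The surjection of `[n + 1]` onto `[n]` that identifies the top two elements. -/
abbrev topCollapse (n : ℕ) : SimplexCategory.mk (n + 1) ⟶ SimplexCategory.mk n :=
  SimplexCategory.σ (Fin.last n)

/-- The inclusion of the last vertex. -/
abbrev lastVertex (n : ℕ) : SimplexCategory.mk 0 ⟶ SimplexCategory.mk n :=
  SimplexCategory.const _ _ (Fin.last n)

theorem topCollapse_castSucc {n : ℕ} (i : Fin (n + 1)) :
    (topCollapse n).toOrderHom i.castSucc = i :=
  Fin.predAbove_last_castSucc

theorem topCollapse_last (n : ℕ) :
    (topCollapse n).toOrderHom (Fin.last (n + 1)) = Fin.last n :=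
  Fin.predAbove_right_last

theorem hom_ext_of_castSucc_of_last {m n : ℕ}
    {f g : SimplexCategory.mk (m + 1) ⟶ SimplexCategory.mk n}
    (h : ∀ i : Fin (m + 1), f.toOrderHom i.castSucc = g.toOrderHom i.castSucc)
    (hl : f.toOrderHom (Fin.last _) = g.toOrderHom (Fin.last _)) : f = g :=
  SimplexCategory.Hom.ext _ _ (OrderHom.ext _ _ (funext (Fin.lastCases hl h)))

theorem topFace_comp_topCollapse (n : ℕ) : topFace n ≫ topCollapse n = 𝟙 _ :=
  SimplexCategory.Hom.ext _ _ (OrderHom.ext _ _ (funext topCollapse_castSucc))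

theorem topFace_comp_addTop {m n : ℕ} (a : SimplexCategory.mk m ⟶ SimplexCategory.mk n) :
    topFace m ≫ addTop.map a = a ≫ topFace n :=
  SimplexCategory.Hom.ext _ _ (addTopHom_comp_castSuccHom a.toOrderHom)

theorem addTop_comp_topCollapse_castSucc {m n : ℕ}
    (a : SimplexCategory.mk m ⟶ SimplexCategory.mk n) (i : Fin (m + 1)) :
    (addTop.map a ≫ topCollapse n).toOrderHom i.castSucc = a.toOrderHom i :=
  (congrArg (topCollapse n).toOrderHom (addTopHom_castSucc _ i)).trans (topCollapse_castSucc _)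

theorem addTop_comp_topCollapse_last {m n : ℕ}
    (a : SimplexCategory.mk m ⟶ SimplexCategory.mk n) :
    (addTop.map a ≫ topCollapse n).toOrderHom (Fin.last (m + 1)) = Fin.last n :=
  (congrArg (topCollapse n).toOrderHom (addTopHom_last _)).trans (topCollapse_last n)

theorem addTop_topFace_comp_topCollapse (n : ℕ) :
    addTop.map (topFace n) ≫ topCollapse (n + 1) = 𝟙 (SimplexCategory.mk (n + 1)) :=
  hom_ext_of_castSucc_of_last (addTop_comp_topCollapse_castSucc _)
    (addTop_comp_topCollapse_last _)

theorem addTop_lastVertex_comp_topCollapse (n : ℕ) :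
    addTop.map (lastVertex n) ≫ topCollapse n = topCollapse 0 ≫ lastVertex n :=
  hom_ext_of_castSucc_of_last (addTop_comp_topCollapse_castSucc (lastVertex n))
    (addTop_comp_topCollapse_last _)

theorem addTop_addTop_comp_topCollapse {m n : ℕ}
    (a : SimplexCategory.mk m ⟶ SimplexCategory.mk n) :
    addTop.map (addTop.map a) ≫ topCollapse (n + 1) = topCollapse (m + 1) ≫ addTop.map a :=
  hom_ext_of_castSucc_of_last
    (fun i => (addTop_comp_topCollapse_castSucc (addTop.map a) i).trans
      (congrArg (addTop.map a).toOrderHom (topCollapse_castSucc i)).symm)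
    ((addTop_comp_topCollapse_last _).trans
      ((congrArg (addTop.map a).toOrderHom (topCollapse_last _)).trans (addTopHom_last _)).symm)

theorem castSucc_comp_eq_of_mk₁_id {C : Type u} [Category.{v} C] {G : ComposableArrows C 2} {T : C}
    (h : (addTop.map (SimplexCategory.const (.mk 0) (.mk 1) 1)).toOrderHom.monotone.functor ⋙ G =
      ComposableArrows.mk₁ (𝟙 T)) :
    (castSuccHom 2).monotone.functor ⋙ G =
      (addTop.map (SimplexCategory.const (.mk 0) (.mk 1) 0)).toOrderHom.monotone.functor ⋙ G := by
  have h₁ : G.obj 1 = T := Functor.congr_obj h 0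
  have h₂ : G.obj 2 = T := Functor.congr_obj h 1
  have h₁₂ : G.map (homOfLE (by decide : (1 : Fin 3) ≤ 2)) ≍ 𝟙 T :=
    Functor.hcongr_hom h (homOfLE (Fin.zero_le 1))
  have hcomp := comp_heq_of_heq_id (G.map (homOfLE (Fin.zero_le 1))) _ h₁ h₂ h₁₂
  rw [← G.map_comp] at hcomp
  exact ComposableArrows.ext₁ rfl (h₁.trans h₂.symm)
    ((conj_eqToHom_iff_heq _ _ rfl (h₁.trans h₂.symm)).2 hcomp.symm)

end TopFace

/-- The structure of a unary operadic category on a category `C`: a predicate singling out the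
chosen terminal objects of the connected components, and a fibre functor `C / X ⥤ C` for each
object `X`. The cardinality functor, being constant, is left out. -/
@[ext]
structure UnaryStructure (C : Type u) [Category.{v} C] where
  IsTerm : C → Prop
  fib : ∀ X : C, Over X ⥤ C
  exists_term : ∀ X, ∃ T, IsTerm T ∧ Nonempty (X ⟶ T)
  term_uniq : ∀ {X T T' : C}, IsTerm T → IsTerm T' → (X ⟶ T) → (X ⟶ T') → T = T'
  hom_uniq : ∀ {X T : C}, IsTerm T → ∀ f g : X ⟶ T, f = g
  isTerm_fib_id : ∀ X, IsTerm ((fib X).obj (Over.mk (𝟙 X)))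
  fib_obj_term : ∀ {T : C}, IsTerm T → ∀ A : Over T, (fib T).obj A = A.left
  fib_map_term : ∀ {T : C}, IsTerm T → ∀ {A B : Over T} (u : A ⟶ B), (fib T).map u ≍ u.left
  fib_obj_fib_map : ∀ {X : C} {A B : Over X} (u : A ⟶ B),
    (fib ((fib X).obj B)).obj (Over.mk ((fib X).map u)) = (fib B.left).obj (Over.mk u.left)
  fib_map_fib_map : ∀ {X : C} {A B D : Over X} (w : A ⟶ B) (u : B ⟶ D),
    (fib ((fib X).obj D)).map
        (Over.homMk ((fib X).map w) :
          Over.mk ((fib X).map w ≫ (fib X).map u) ⟶ Over.mk ((fib X).map u)) ≍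
      (fib D.left).map (Over.homMk w.left : Over.mk (w.left ≫ u.left) ⟶ Over.mk u.left)

namespace UnaryStructure

variable {C : Type u} [Category.{v} C] (S : UnaryStructure C)

theorem uniq {X T T' : C} (hT : S.IsTerm T) (hT' : S.IsTerm T') (f : X ⟶ T) (g : X ⟶ T') :
    T = T' ∧ f ≍ g := by
  obtain rfl := S.term_uniq hT hT' f g
  exact ⟨rfl, heq_of_eq (S.hom_uniq hT f g)⟩

theorem fib_map_fib_map_of_eq {X : C} {A B D : Over X} (w : A ⟶ B) (u : B ⟶ D) (t : A ⟶ D)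
    (h : w ≫ u = t) :
    (S.fib ((S.fib X).obj D)).map
        (Over.homMk ((S.fib X).map w) (by simp [← h]) :
          Over.mk ((S.fib X).map t) ⟶ Over.mk ((S.fib X).map u)) ≍
      (S.fib D.left).map (Over.homMk w.left (by simp [← h]) : Over.mk t.left ⟶ Over.mk u.left) := by
  subst h
  exact ((map_homMk_heq _ ((S.fib X).map_comp w u) _ _).trans (S.fib_map_fib_map w u)).trans
    (map_homMk_heq _ (rfl : w.left ≫ u.left = (w ≫ u).left) _ _)

theorem exists_chain {n : ℕ} (G : Fin (n + 1) ⥤ C) :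
    ∃ F : Fin (n + 2) ⥤ C, S.IsTerm (F.obj (Fin.last _)) ∧
      (castSuccHom (n + 1)).monotone.functor ⋙ F = G := by
  obtain ⟨T, hT, ⟨f⟩⟩ := S.exists_term (G.obj (Fin.last n))
  let H : Fin (n + 1) ⥤ Over T :=
    { obj i := Over.mk (G.map (homOfLE (Fin.le_last i)) ≫ f)
      map g := Over.homMk (G.map g) (S.hom_uniq hT _ _)
      map_id i := by ext; exact G.map_id i
      map_comp g g' := by ext; exact G.map_comp g g' }
  exact ⟨snoc H, (snoc_last H).symm ▸ hT, castSucc_comp_snoc H⟩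

variable {m n : ℕ}

/-- The chain of fibres over the object at `b` of the restriction along `a` of a chain. -/
def fibreChain (F : Fin n ⥤ C) (a : Fin m →o Fin n) (b : Fin n) (h : ∀ i, a i ≤ b) :
    Fin m ⥤ C :=
  overRestrict F a b h ⋙ S.fib (F.obj b)

theorem fibreChain_congr (F : Fin n ⥤ C) {a a' : Fin m →o Fin n} (ha : a = a')
    {b b' : Fin n} (hb : b = b') (h : ∀ i, a i ≤ b) (h' : ∀ i, a' i ≤ b') :
    S.fibreChain F a b h = S.fibreChain F a' b' h' := by
  subst ha hb
  rfl

theorem fibreChain_of_isTerm (F : Fin n ⥤ C) (a : Fin m →o Fin n) (b : Fin n)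
    (h : ∀ i, a i ≤ b) (hb : S.IsTerm (F.obj b)) :
    S.fibreChain F a b h = a.monotone.functor ⋙ F :=
  Functor.hext (fun _ => S.fib_obj_term hb _) (fun _ _ _ => S.fib_map_term hb _)

theorem fibreChain_fibreChain {k : ℕ} (F : Fin n ⥤ C) (a : Fin m →o Fin n) (b : Fin n)
    (h : ∀ i, a i ≤ b) (a' : Fin k →o Fin m) (b' : Fin m) (h' : ∀ i, a' i ≤ b') :
    S.fibreChain (S.fibreChain F a b h) a' b' h' =
      S.fibreChain F (a.comp a') (a b') (fun i => a.monotone (h' i)) := by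
  refine Functor.hext (fun i => S.fib_obj_fib_map _) (fun i j f => ?_)
  exact S.fib_map_fib_map_of_eq ((overRestrict F a b h).map (homOfLE (a'.monotone (leOfHom f))))
    ((overRestrict F a b h).map (homOfLE (h' j))) ((overRestrict F a b h).map (homOfLE (h' i)))
    (by rw [← Functor.map_comp]; rfl)

theorem isTerm_fibreChain (F : Fin n ⥤ C) (a : Fin m →o Fin n) (i : Fin m)
    (h : ∀ j, a j ≤ a i) : S.IsTerm ((S.fibreChain F a (a i) h).obj i) := by
  have := S.isTerm_fib_id (F.obj (a i))
  rw [← F.map_id] at this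
  exact this

/-- A functor that preserves the chosen terminal objects and the fibre functors. -/
structure IsMap {C D : Type*} [Category* C] [Category* D] (S : UnaryStructure C)
    (T : UnaryStructure D) (F : C ⥤ D) : Prop where
  isTerm : ∀ {X}, S.IsTerm X → T.IsTerm (F.obj X)
  fib_comp : ∀ X, S.fib X ⋙ F = Over.post F ⋙ T.fib (F.obj X)

variable {D : Type*} [Category* D] {S} {T : UnaryStructure D} {F : C ⥤ D}

theorem IsMap.fibreChain_comp (hF : S.IsMap T F) (G : Fin n ⥤ C)
    (a : Fin m →o Fin n) (b : Fin n) (h : ∀ i, a i ≤ b) :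
    S.fibreChain G a b h ⋙ F = T.fibreChain (G ⋙ F) a b h :=
  congrArg (overRestrict G a b h ⋙ ·) (hF.fib_comp (G.obj b))

theorem IsMap.of_fibreChain_comp (hterm : ∀ {X}, S.IsTerm X → T.IsTerm (F.obj X))
    (hfib : ∀ {n : ℕ} (G : Fin (n + 1) ⥤ C), S.fibreChain G .id (Fin.last n) Fin.le_last ⋙ F =
      T.fibreChain (G ⋙ F) .id (Fin.last n) Fin.le_last) : S.IsMap T F := by
  refine ⟨hterm, fun X => Functor.hext (fun A => ?_) (fun A B v => ?_)⟩
  · exact Functor.congr_obj (hfib (ComposableArrows.mk₁ A.hom)) 0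
  · have hw : v.left ≫ B.hom = A.hom := Over.w v
    have hdom : (S.fib X).obj A = (S.fib X).obj (Over.mk (v.left ≫ B.hom)) :=
      congrArg (fun k : A.left ⟶ X => (S.fib X).obj (Over.mk k)) hw.symm
    have hmap := Functor.hcongr_hom (hfib (ComposableArrows.mk₂ v.left B.hom))
      (homOfLE (Fin.zero_le 1))
    exact (OpCat.map_heq F hdom rfl (map_homMk_heq _ hw.symm hw rfl)).trans (hmap.trans
      (map_homMk_heq _ (congrArg F.map hw) (F.map_comp _ _).symm
        ((F.map_comp _ _).symm.trans (congrArg F.map hw))))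

end UnaryStructure

section OperadicNerve

variable {C D : Type u} [SmallCategory C] [SmallCategory D]

/-- The nerve of a unary operadic category: its `n`-simplices are the chains of `n` morphisms
that end in a chosen terminal object. As the last object of a simplex may drop out of a face, the
face is made of fibres over the last object that remains. -/
def operadicNerve (S : UnaryStructure C) : SSet.{u} where
  obj Δ := { F : ComposableArrows C Δ.unop.len // S.IsTerm (F.obj (Fin.last _)) }
  map f := ↾fun F => ⟨S.fibreChain F.1 f.unop.toOrderHom (f.unop.toOrderHom (Fin.last _))
    (fun i => f.unop.toOrderHom.monotone (Fin.le_last i)), S.isTerm_fibreChain _ _ _ _⟩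
  map_id _ := ConcreteCategory.hom_ext _ _ fun F =>
    Subtype.ext (S.fibreChain_of_isTerm _ _ _ _ F.2)
  map_comp f g := ConcreteCategory.hom_ext _ _ fun F => Subtype.ext
    (S.fibreChain_fibreChain F.1 f.unop.toOrderHom _ _ g.unop.toOrderHom
      (g.unop.toOrderHom (Fin.last _)) _).symm

variable {S : UnaryStructure C} {T : UnaryStructure D} {F : C ⥤ D}

/-- The map of nerves induced by a functor that preserves the structures. -/
def operadicNerveMap (hF : S.IsMap T F) : operadicNerve S ⟶ operadicNerve T where
  app _ := ↾fun x => ⟨x.1 ⋙ F, hF.isTerm x.2⟩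
  naturality _ _ f := ConcreteCategory.hom_ext _ _ fun x => Subtype.ext
    (hF.fibreChain_comp x.1 f.unop.toOrderHom _ _)

theorem castSucc_comp_operadicNerve_map_of_last {m n : ℕ} (x : (operadicNerve S).obj (op (.mk n)))
    (a : SimplexCategory.mk (m + 1) ⟶ SimplexCategory.mk n) {b : Fin (m + 1) →o Fin (n + 1)}
    (hl : a.toOrderHom (Fin.last _) = Fin.last _) (hb : a.toOrderHom.comp (castSuccHom _) = b) :
    (castSuccHom (m + 1)).monotone.functor ⋙ ((operadicNerve S).map a.op x).1 =
      b.monotone.functor ⋙ x.1 := by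
  subst hb
  have hterm : S.IsTerm (x.1.obj (a.toOrderHom (Fin.last (m + 1)))) := hl.symm ▸ x.2
  exact congrArg ((castSuccHom (m + 1)).monotone.functor ⋙ ·)
    (S.fibreChain_of_isTerm x.1 a.toOrderHom _ _ hterm)

variable (S)

/-- The map from the décalage of the nerve of a unary operadic category to the nerve of its
underlying category that forgets the last object of a chain. -/
def decOperadicNerve : dec.obj (operadicNerve S) ⟶ nerve C where
  app Δ := ↾fun x => (castSuccHom (Δ.unop.len + 1)).monotone.functor ⋙ x.1
  naturality _ _ f := ConcreteCategory.hom_ext _ _ fun x =>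
    castSucc_comp_operadicNerve_map_of_last x (addTop.map f.unop)
      (addTopHom_last f.unop.toOrderHom) (addTopHom_comp_castSuccHom f.unop.toOrderHom)

theorem decOperadicNerve_naturality (hF : S.IsMap T F) :
    dec.map (operadicNerveMap hF) ≫ decOperadicNerve T = decOperadicNerve S ≫ nerveMap F :=
  rfl

instance : IsIso (decOperadicNerve S) := by
  rw [NatTrans.isIso_iff_isIso_app]
  intro Δ
  rw [isIso_iff_bijective]
  refine ⟨fun x y h => Subtype.ext (chain_ext_of_unique_last S.uniq h x.2 y.2), fun G => ?_⟩
  obtain ⟨F, hF, h⟩ := S.exists_chain G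
  exact ⟨⟨F, hF⟩, h⟩

theorem decOperadicNerve_topCollapse {n : ℕ} (x : (operadicNerve S).obj (op (.mk n))) :
    (decOperadicNerve S).app (op (.mk n)) ((operadicNerve S).map (topCollapse n).op x) = x.1 :=
  castSucc_comp_operadicNerve_map_of_last x (topCollapse n) (b := .id) (topCollapse_last n)
    (OrderHom.ext _ _ (funext topCollapse_castSucc))

variable {S} (φ : operadicNerve S ⟶ operadicNerve T)

theorem exists_dec_map_comp_eq :
    ∃ F : C ⥤ D, dec.map φ ≫ decOperadicNerve T = decOperadicNerve S ≫ nerveMap F := by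
  obtain ⟨F, hF⟩ := nerveFunctor.{u, u}.map_surjective (X := Cat.of C) (Y := Cat.of D)
    ((asIso (decOperadicNerve S)).inv ≫ dec.map φ ≫ decOperadicNerve T)
  exact ⟨F.toFunctor, (Iso.inv_comp_eq _).1 hF.symm⟩

variable {φ}

theorem val_app_of_dec_map_comp_eq
    (hF : dec.map φ ≫ decOperadicNerve T = decOperadicNerve S ≫ nerveMap F) {n : ℕ}
    (x : (operadicNerve S).obj (op (.mk n))) : (φ.app _ x).1 = x.1 ⋙ F := by
  rw [← decOperadicNerve_topCollapse, ← decOperadicNerve_topCollapse S x]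
  exact (congrArg ((decOperadicNerve T).app (op (.mk n)))
    (ConcreteCategory.congr_hom (φ.naturality (topCollapse n).op) x).symm).trans
      (ConcreteCategory.congr_hom (NatTrans.congr_app hF (op (.mk n)))
        ((operadicNerve S).map (topCollapse n).op x))

theorem isMap_of_val_app_eq
    (hφ : ∀ {n : ℕ} (x : (operadicNerve S).obj (op (.mk n))), (φ.app _ x).1 = x.1 ⋙ F) :
    S.IsMap T F := by
  refine .of_fibreChain_comp (fun {X} hX => ?_) (fun {n} G => ?_)
  · let x : (operadicNerve S).obj (op (.mk 0)) := ⟨ComposableArrows.mk₀ X, hX⟩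
    have hx := (φ.app _ x).2
    rw [hφ] at hx
    exact hx
  · obtain ⟨G', hG', rfl⟩ := S.exists_chain G
    let x : (operadicNerve S).obj (op (.mk (n + 1))) := ⟨G', hG'⟩
    have hface := congrArg Subtype.val
      (ConcreteCategory.congr_hom (φ.naturality (topFace n).op) x)
    exact (hφ _).symm.trans (hface.trans
      (congrArg (fun G => T.fibreChain G (castSuccHom (n + 1)) (Fin.last n).castSucc
        (fun i => (Fin.castSucc_le_castSucc_iff.2 (Fin.le_last i)))) (hφ x)))

variable (φ)

theorem exists_eq_operadicNerveMap :
    ∃ (F : C ⥤ D) (hF : S.IsMap T F), operadicNerveMap hF = φ := by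
  obtain ⟨F, hF⟩ := exists_dec_map_comp_eq φ
  refine ⟨F, isMap_of_val_app_eq (val_app_of_dec_map_comp_eq hF), ?_⟩
  ext Δ x
  exact Subtype.ext (val_app_of_dec_map_comp_eq hF x).symm

end OperadicNerve

namespace DecNerve

variable {K : SSet.{u}} {C : Type u} [SmallCategory C] (e : dec.obj K ≅ nerve C)

/-- The simplex of `K` that corresponds to a chain. -/
def ofChain {n : ℕ} (G : ComposableArrows C n) : K.obj (op (.mk (n + 1))) :=
  e.inv.app (op (.mk n)) G

/-- The chain that corresponds to a simplex of `K`. -/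
def toChain {n : ℕ} (x : K.obj (op (.mk (n + 1)))) : ComposableArrows C n :=
  e.hom.app (op (.mk n)) x

@[simp]
theorem toChain_ofChain {n : ℕ} (G : ComposableArrows C n) : toChain e (ofChain e G) = G :=
  ConcreteCategory.congr_hom (e.inv_hom_id_app (op (.mk n))) G

@[simp]
theorem ofChain_toChain {n : ℕ} (x : K.obj (op (.mk (n + 1)))) : ofChain e (toChain e x) = x :=
  ConcreteCategory.congr_hom (e.hom_inv_id_app (op (.mk n))) x

theorem toChain_map_addTop {m n : ℕ} (a : SimplexCategory.mk m ⟶ SimplexCategory.mk n)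
    (x : K.obj (op (.mk (n + 1)))) :
    toChain e (K.map (addTop.map a).op x) = a.toOrderHom.monotone.functor ⋙ toChain e x :=
  ConcreteCategory.congr_hom (e.hom.naturality a.op) x

theorem ofChain_comp {m n : ℕ} (a : SimplexCategory.mk m ⟶ SimplexCategory.mk n)
    (G : ComposableArrows C n) :
    ofChain e (a.toOrderHom.monotone.functor ⋙ G) = K.map (addTop.map a).op (ofChain e G) :=
  ConcreteCategory.congr_hom (e.inv.naturality a.op) G

/-- An object is a chosen terminal object if it is degenerate as a `1`-simplex of `K`. -/
def IsTerm (X : C) : Prop :=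
  ∃ k : K.obj (op (.mk 0)), ofChain e (ComposableArrows.mk₀ X) = K.map (topCollapse 0).op k

/-- The chain that corresponds to the top degeneracy of an `n`-simplex of `K`. These are the
chains of `n` morphisms that end in a chosen terminal object. -/
def termChain {n : ℕ} (x : K.obj (op (.mk n))) : ComposableArrows C n :=
  toChain e (K.map (topCollapse n).op x)

theorem map_topFace_ofChain_termChain {n : ℕ} (x : K.obj (op (.mk n))) :
    K.map (topFace n).op (ofChain e (termChain e x)) = x := by
  rw [termChain, ofChain_toChain, map_map_of_eq K (topFace_comp_topCollapse n)]
  exact map_of_eq_id K rfl x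

theorem isTerm_termChain_last {n : ℕ} (x : K.obj (op (.mk n))) :
    IsTerm e ((termChain e x).obj (Fin.last n)) := by
  refine ⟨K.map (lastVertex n).op x, ?_⟩
  have hlast : ComposableArrows.mk₀ ((termChain e x).obj (Fin.last n)) =
      (lastVertex n).toOrderHom.monotone.functor ⋙ termChain e x := ComposableArrows.ext₀ rfl
  rw [hlast, ofChain_comp, termChain, ofChain_toChain]
  exact (map_map_of_eq K (addTop_lastVertex_comp_topCollapse n) x).trans
    (map_map_of_eq K rfl x).symm

theorem castSucc_comp_termChain {n : ℕ} (x : K.obj (op (.mk (n + 1)))) :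
    (castSuccHom (n + 1)).monotone.functor ⋙ termChain e x = toChain e x :=
  (toChain_map_addTop e (topFace n) _).symm.trans (congrArg (toChain e)
    ((map_map_of_eq K (addTop_topFace_comp_topCollapse n) x).trans (map_of_eq_id K rfl x)))

theorem termChain_map_addTop {m n : ℕ} (a : SimplexCategory.mk m ⟶ SimplexCategory.mk n)
    (x : K.obj (op (.mk (n + 1)))) :
    termChain e (K.map (addTop.map a).op x) =
      (addTop.map a).toOrderHom.monotone.functor ⋙ termChain e x :=
  (congrArg (toChain e) ((map_map_of_eq K rfl x).trans
    (map_map_of_eq K (addTop_addTop_comp_topCollapse a) x).symm)).trans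
      (toChain_map_addTop e (addTop.map a) _)

/-- The extension of a chain by the chosen terminal object of its connected component. -/
def cone {n : ℕ} (G : ComposableArrows C n) : ComposableArrows C (n + 1) :=
  termChain e (ofChain e G)

theorem isTerm_cone_last {n : ℕ} (G : ComposableArrows C n) :
    IsTerm e ((cone e G).obj (Fin.last _)) :=
  isTerm_termChain_last e _

theorem castSucc_comp_cone {n : ℕ} (G : ComposableArrows C n) :
    (castSuccHom (n + 1)).monotone.functor ⋙ cone e G = G :=
  (castSucc_comp_termChain e _).trans (toChain_ofChain e G)

theorem cone_comp {m n : ℕ} (a : SimplexCategory.mk m ⟶ SimplexCategory.mk n)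
    (G : ComposableArrows C n) :
    cone e (a.toOrderHom.monotone.functor ⋙ G) =
      (addTop.map a).toOrderHom.monotone.functor ⋙ cone e G :=
  (congrArg (termChain e) (ofChain_comp e a G)).trans (termChain_map_addTop e a _)

theorem cone_mk₀_of_isTerm {T : C} (hT : IsTerm e T) :
    cone e (ComposableArrows.mk₀ T) = ComposableArrows.mk₁ (𝟙 T) := by
  obtain ⟨k, hk⟩ := hT
  have hσ : topCollapse 1 ≫ topCollapse 0 = addTop.map (topCollapse 0) ≫ topCollapse 0 :=
    SimplexCategory.Hom.ext _ _
      (OrderHom.ext _ _ (funext fun _ => Subsingleton.elim (α := Fin 1) _ _))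
  calc cone e (ComposableArrows.mk₀ T)
      = toChain e (K.map (addTop.map (topCollapse 0)).op (ofChain e (ComposableArrows.mk₀ T))) := by
        rw [cone, termChain, hk, map_map_of_eq K hσ]
        exact congrArg (toChain e) (map_map_of_eq K rfl k).symm
    _ = (topCollapse 0).toOrderHom.monotone.functor ⋙ ComposableArrows.mk₀ T :=
        (toChain_map_addTop e _ _).trans
          (congrArg ((topCollapse 0).toOrderHom.monotone.functor ⋙ ·) (toChain_ofChain e _))
    _ = ComposableArrows.mk₁ (𝟙 T) := nerve.σ₀_mk₀_eq T

theorem mk₁_eq_cone_of_isTerm {X T : C} (hT : IsTerm e T) (f : X ⟶ T) :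
    ComposableArrows.mk₁ f = cone e (ComposableArrows.mk₀ X) := by
  have h₀₁ := castSucc_comp_cone e (ComposableArrows.mk₁ f)
  have h₀₂ : cone e (ComposableArrows.mk₀ X) = _ :=
    (congrArg (cone e) (ComposableArrows.ext₀ rfl)).trans
      (cone_comp e (SimplexCategory.const (.mk 0) (.mk 1) 0) (ComposableArrows.mk₁ f))
  have h₁₂ := ((cone_comp e (SimplexCategory.const (.mk 0) (.mk 1) 1)
    (ComposableArrows.mk₁ f)).symm.trans (congrArg (cone e) (ComposableArrows.ext₀ rfl))).trans
      (cone_mk₀_of_isTerm e hT)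
  rw [h₀₂]
  exact h₀₁.symm.trans (castSucc_comp_eq_of_mk₁_id h₁₂)

theorem uniq {X T T' : C} (hT : IsTerm e T) (hT' : IsTerm e T') (f : X ⟶ T) (g : X ⟶ T') :
    T = T' ∧ f ≍ g := by
  have h := (mk₁_eq_cone_of_isTerm e hT f).trans (mk₁_eq_cone_of_isTerm e hT' g).symm
  exact ⟨Functor.congr_obj h 1, Functor.hcongr_hom h (homOfLE (by decide : (0 : Fin 2) ≤ 1))⟩

theorem exists_term (X : C) : ∃ T, IsTerm e T ∧ Nonempty (X ⟶ T) := by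
  have h : (cone e (ComposableArrows.mk₀ X)).obj 0 = X :=
    Functor.congr_obj (castSucc_comp_cone e (ComposableArrows.mk₀ X)) 0
  exact ⟨_, isTerm_cone_last e _, ⟨eqToHom h.symm ≫
    (cone e (ComposableArrows.mk₀ X)).map (homOfLE (Fin.zero_le 1))⟩⟩

theorem cone_castSucc_comp_of_isTerm {n : ℕ} (G : ComposableArrows C (n + 1))
    (hG : IsTerm e (G.obj (Fin.last _))) :
    cone e ((castSuccHom (n + 1)).monotone.functor ⋙ G) = G :=
  chain_ext_of_unique_last (uniq e) (castSucc_comp_cone e _) (isTerm_cone_last e _) hG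

theorem exists_termChain_eq {n : ℕ} (G : ComposableArrows C n)
    (hG : IsTerm e (G.obj (Fin.last _))) : ∃ x, termChain e x = G := by
  cases n with
  | zero =>
    obtain ⟨k, hk⟩ := hG
    refine ⟨k, (congrArg (toChain e) hk.symm).trans ((toChain_ofChain e _).trans ?_)⟩
    exact ComposableArrows.ext₀ rfl
  | succ n => exact ⟨_, cone_castSucc_comp_of_isTerm e G hG⟩

/-- The operation on chains that corresponds to the top face map of `K`. -/
def face {n : ℕ} (G : ComposableArrows C (n + 1)) : ComposableArrows C n :=
  toChain e (K.map (topFace (n + 1)).op (ofChain e G))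

theorem face_comp {m n : ℕ} (a : SimplexCategory.mk (m + 1) ⟶ SimplexCategory.mk n)
    (G : ComposableArrows C n) :
    face e (a.toOrderHom.monotone.functor ⋙ G) =
      toChain e (K.map a.op (K.map (topFace n).op (ofChain e G))) :=
  (congrArg (fun x => toChain e (K.map (topFace (m + 1)).op x)) (ofChain_comp e a G)).trans
    (congrArg (toChain e) ((map_map_of_eq K (topFace_comp_addTop a) _).trans
      (map_map_of_eq K rfl _).symm))

theorem face_addTop_comp {m n : ℕ} (a : SimplexCategory.mk m ⟶ SimplexCategory.mk n)
    (G : ComposableArrows C (n + 1)) :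
    face e ((addTopHom a.toOrderHom).monotone.functor ⋙ G) =
      a.toOrderHom.monotone.functor ⋙ face e G :=
  (face_comp e (addTop.map a) G).trans (toChain_map_addTop e a _)

theorem face_face {n : ℕ} (G : ComposableArrows C (n + 2)) :
    face e (face e G) = face e ((castSuccHom (n + 2)).monotone.functor ⋙ G) :=
  (congrArg (fun x => toChain e (K.map (topFace (n + 1)).op x)) (ofChain_toChain e _)).trans
    (face_comp e (topFace (n + 1)) G).symm

theorem face_comp_termChain {m n : ℕ} (a : SimplexCategory.mk (m + 1) ⟶ SimplexCategory.mk n)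
    (x : K.obj (op (.mk n))) :
    face e (a.toOrderHom.monotone.functor ⋙ termChain e x) = toChain e (K.map a.op x) := by
  rw [face_comp, map_topFace_ofChain_termChain]

theorem face_of_isTerm {n : ℕ} (G : ComposableArrows C (n + 1))
    (hG : IsTerm e (G.obj (Fin.last _))) :
    face e G = (castSuccHom (n + 1)).monotone.functor ⋙ G := by
  obtain ⟨x, rfl⟩ := exists_termChain_eq e G hG
  rw [face, map_topFace_ofChain_termChain, castSucc_comp_termChain]

/-- The map of nerves that defines the fibre functor over `X`. -/
noncomputable def fibNerve (X : C) : nerve (Over X) ⟶ nerve C where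
  app Δ := ↾fun H => face e (snoc H : ComposableArrows C (Δ.unop.len + 1))
  naturality _ _ f := ConcreteCategory.hom_ext _ _ fun H =>
    (congrArg (face e) (snoc_comp H f.unop.toOrderHom)).trans (face_addTop_comp e f.unop _)

/-- The fibre functor over `X`: a chain of objects over `X` is sent to the top face of its
extension by `X`. -/
noncomputable def fib (X : C) : Over X ⥤ C :=
  (nerveFunctor.preimage (X := Cat.of (Over X)) (Y := Cat.of C) (fibNerve e X)).toFunctor

theorem comp_fib {X : C} {n : ℕ} (H : ComposableArrows (Over X) n) :
    H ⋙ fib e X = face e (snoc H : ComposableArrows C (n + 1)) :=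
  ConcreteCategory.congr_hom (NatTrans.congr_app (nerveFunctor.map_preimage
    (X := Cat.of (Over X)) (Y := Cat.of C) (fibNerve e X)) (op (.mk n))) H

theorem overLast_comp_fib {n : ℕ} (G : ComposableArrows C (n + 1)) :
    overLast G ⋙ fib e (G.obj (Fin.last _)) = face e G :=
  (comp_fib e _).trans (congrArg (face e) (snoc_overLast G))

theorem isTerm_fib_id (X : C) : IsTerm e ((fib e X).obj (Over.mk (𝟙 X))) := by
  have hface : face e (ComposableArrows.mk₁ (𝟙 X)) =
      termChain e (K.map (topFace 0).op (ofChain e (ComposableArrows.mk₀ X))) :=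
    (congrArg (face e) (nerve.σ₀_mk₀_eq X).symm).trans (face_comp e (topCollapse 0) _)
  have hobj := Functor.congr_obj
    ((overLast_comp_fib e (ComposableArrows.mk₁ (𝟙 X))).trans hface) 0
  exact (congrArg (IsTerm e) hobj).mpr (isTerm_termChain_last e (n := 0) _)

theorem comp_fib_of_isTerm {T : C} (hT : IsTerm e T) {n : ℕ} (H : ComposableArrows (Over T) n) :
    H ⋙ fib e T = H ⋙ Over.forget T := by
  rw [comp_fib, face_of_isTerm, castSucc_comp_snoc]
  rwa [snoc_last]

theorem overLast_comp_fib_comp_fib {X : C} {n : ℕ} (H : ComposableArrows (Over X) (n + 1)) :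
    overLast (H ⋙ fib e X) ⋙ fib e ((fib e X).obj (H.obj (Fin.last _))) =
      overLast (H ⋙ Over.forget X) ⋙ fib e (H.obj (Fin.last _)).left := by
  refine (overLast_comp_fib e (H ⋙ fib e X)).trans (Eq.trans ?_
    (overLast_comp_fib e (H ⋙ Over.forget X)).symm)
  rw [comp_fib, face_face, castSucc_comp_snoc]

/-- The unary operadic structure on a category `C` that is determined by a simplicial set whose
décalage is the nerve of `C`. -/
noncomputable def unaryStructure : UnaryStructure C where
  IsTerm := IsTerm e
  fib := fib e
  exists_term := exists_term e
  term_uniq hT hT' f g := (uniq e hT hT' f g).1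
  hom_uniq hT f g := eq_of_heq (uniq e hT hT f g).2
  isTerm_fib_id := isTerm_fib_id e
  fib_obj_term hT A := Functor.congr_obj (comp_fib_of_isTerm e hT (ComposableArrows.mk₀ A)) 0
  fib_map_term hT _ _ w := Functor.hcongr_hom (comp_fib_of_isTerm e hT (ComposableArrows.mk₁ w))
    (homOfLE (by decide : (0 : Fin 2) ≤ 1))
  fib_obj_fib_map w :=
    Functor.congr_obj (overLast_comp_fib_comp_fib e (ComposableArrows.mk₁ w)) 0
  fib_map_fib_map {X A B D} w v :=
    (map_homMk_heq _ ((fib e X).map_comp w v).symm rfl ((fib e X).map_comp w v).symm).trans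
      ((Functor.hcongr_hom (overLast_comp_fib_comp_fib e (ComposableArrows.mk₂ w v))
        (homOfLE (by decide : (0 : Fin 2) ≤ 1))).trans
          (map_homMk_heq _ (rfl : (w ≫ v).left = w.left ≫ v.left) rfl rfl))

theorem termChain_map {m n : ℕ} (a : SimplexCategory.mk m ⟶ SimplexCategory.mk n)
    (x : K.obj (op (.mk n))) :
    termChain e (K.map a.op x) =
      (unaryStructure e).fibreChain (termChain e x) a.toOrderHom (a.toOrderHom (Fin.last _))
        (fun i => a.toOrderHom.monotone (Fin.le_last i)) := by
  let b := topCollapse m ≫ a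
  have hb : b.toOrderHom.comp (castSuccHom _) = a.toOrderHom :=
    OrderHom.ext _ _ (funext fun i => congrArg a.toOrderHom (topCollapse_castSucc i))
  have hl : b.toOrderHom (Fin.last _) = a.toOrderHom (Fin.last _) :=
    congrArg a.toOrderHom (topCollapse_last _)
  calc termChain e (K.map a.op x)
      = toChain e (K.map b.op x) := congrArg (toChain e) (map_map_of_eq K rfl x)
    _ = face e (b.toOrderHom.monotone.functor ⋙ termChain e x) :=
        (face_comp_termChain e b x).symm
    _ = overLast (b.toOrderHom.monotone.functor ⋙ termChain e x) ⋙ fib e _ :=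
        (overLast_comp_fib e _).symm
    _ = _ := (unaryStructure e).fibreChain_congr (termChain e x) hb hl
        (fun i => b.toOrderHom.monotone (Fin.le_last _)) _

/-- A simplicial set whose décalage is the nerve of `C` maps to the nerve of the unary operadic
structure on `C`. -/
noncomputable def toOperadicNerve : K ⟶ operadicNerve (unaryStructure e) where
  app _ := ↾fun x => ⟨termChain e x, isTerm_termChain_last e x⟩
  naturality _ _ a := ConcreteCategory.hom_ext _ _ fun x => Subtype.ext (termChain_map e a.unop x)

instance : IsIso (toOperadicNerve e) := by
  rw [NatTrans.isIso_iff_isIso_app]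
  rintro ⟨⟨n⟩⟩
  rw [isIso_iff_bijective]
  refine ⟨fun x y h => ?_, fun F => ?_⟩
  · have hxy : termChain e x = termChain e y := congrArg Subtype.val h
    rw [← map_topFace_ofChain_termChain e x, hxy, map_topFace_ofChain_termChain]
  · obtain ⟨x, hx⟩ := exists_termChain_eq e F.1 F.2
    exact ⟨x, Subtype.ext hx⟩

end DecNerve

namespace FinOrdinal

theorem hom_heq {a b a' b' : FinOrdinal} (ha : a = a') (hb : b = one) (hb' : b' = one)
    (f : a ⟶ b) (g : a' ⟶ b') : f ≍ g := by
  subst ha hb hb'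
  exact heq_of_eq (funext fun _ => Subsingleton.elim (α := Fin 1) _ _)

theorem subsingleton_of_eq_one {a : FinOrdinal} (h : a = one) : Subsingleton (Fin a.n) := by
  subst h
  exact inferInstanceAs (Subsingleton (Fin 1))

theorem fibre_of_eq_one {a b : FinOrdinal} (hb : b = one) (f : a ⟶ b) (i : Fin b.n) :
    fibre f i = a := by
  have := subsingleton_of_eq_one hb
  have huniv : fibreSet f i = Finset.univ :=
    Finset.filter_true_of_mem fun _ _ => Subsingleton.elim _ _
  rw [fibre, huniv, Finset.card_fin]

end FinOrdinal

theorem LocalTerminals.eq_mk_of_hom {C : Type u} [Category.{v} C] (t : LocalTerminals C) {X : C}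
    {c : CategoryTheory.ConnectedComponents C} (f : X ⟶ t.term c) :
    c = CategoryTheory.ConnectedComponents.mk X :=
  ((Quotient.sound (Zigzag.of_hom f)).trans (t.term_mem c)).symm

section OverInduction

variable {C : Type*} [Category* C] {X : C}

theorem over_hom_induction {motive : ∀ A B : Over X, (A ⟶ B) → Prop}
    (homMk : ∀ {Z Y : C} (g : Z ⟶ Y) (f : Y ⟶ X),
      motive (Over.mk (g ≫ f)) (Over.mk f) (Over.homMk g))
    {A B : Over X} (u : A ⟶ B) : motive A B u := by
  obtain ⟨Z, ⟨⟨⟩⟩, k⟩ := A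
  obtain ⟨Y, ⟨⟨⟩⟩, f⟩ := B
  obtain ⟨(g : Z ⟶ Y), (hk : g ≫ f = k), rfl⟩ := Over.homMk_surjective u
  subst hk
  exact homMk g f

theorem over_hom_hom_induction {motive : ∀ A B D : Over X, (A ⟶ B) → (B ⟶ D) → Prop}
    (homMk : ∀ {W Z Y : C} (h : W ⟶ Z) (g : Z ⟶ Y) (f : Y ⟶ X),
      motive (Over.mk (h ≫ g ≫ f)) (Over.mk (g ≫ f)) (Over.mk f) (Over.homMk h) (Over.homMk g))
    {A B D : Over X} (w : A ⟶ B) (u : B ⟶ D) : motive A B D w u := by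
  obtain ⟨W, ⟨⟨⟩⟩, k⟩ := A
  induction u using over_hom_induction with
  | @homMk Z Y g f =>
    obtain ⟨(h : W ⟶ Z), (hk : h ≫ g ≫ f = k), rfl⟩ := Over.homMk_surjective w
    subst hk
    exact homMk h g f

end OverInduction

namespace OpCat

theorem subsingleton_card {A : OpCat.{u}} (hA : isUnary A) (X : A.carrier) :
    Subsingleton (Fin (A.str.card.obj X).n) :=
  FinOrdinal.subsingleton_of_eq_one (hA X)

variable (A : OpCat.{u}) (hA : isUnary A)

/-- The only element of the cardinality of an object of a unary operadic category. -/
def point (X : A.carrier) : Fin (A.str.card.obj X).n :=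
  Fin.cast (congrArg FinOrdinal.n (hA X).symm) (0 : Fin 1)

theorem fibre_fibreMap_point {Z Y X : A.carrier} (g : Z ⟶ Y) (f : Y ⟶ X) :
    A.str.fibre (A.str.fibreMap g f (A.point hA X)) (A.point hA _) =
      A.str.fibre g (A.point hA Y) := by
  have (X : A.carrier) := subsingleton_card hA X
  exact (A.isOperadic.fibre_fibreMap g f _ (Fin.cast (congrArg FinOrdinal.n
    (A.isOperadic.card_fibre f _)) (A.point hA _))).trans
      (congrArg (A.str.fibre g) (Subsingleton.elim _ _))

theorem fibreMap_fibreMap_point {W Z Y X : A.carrier} (h : W ⟶ Z) (g : Z ⟶ Y) (f : Y ⟶ X) :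
    A.str.fibreMap (A.str.fibreMap h (g ≫ f) (A.point hA X)) (A.str.fibreMap g f (A.point hA X))
        (A.point hA _) ≍
      A.str.fibreMap h g (A.point hA Y) := by
  have (X : A.carrier) := subsingleton_card hA X
  exact (A.isOperadic.fibreMap_fibreMap h g f _ (Fin.cast (congrArg FinOrdinal.n
    (A.isOperadic.card_fibre f _)) (A.point hA _))).trans
      (congr_arg_heq (A.str.fibreMap h g) (Subsingleton.elim _ _))

/-- The unary structure of a unary operadic category. -/
def unaryStructure : UnaryStructure A.carrier where
  IsTerm X := ∃ c, X = A.str.term c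
  fib X := A.str.fibreFunctor X (A.point hA X)
  exists_term X := ⟨_, ⟨_, rfl⟩, ⟨A.str.τ X⟩⟩
  term_uniq := by
    rintro X _ _ ⟨c, rfl⟩ ⟨c', rfl⟩ f g
    rw [A.str.eq_mk_of_hom f, A.str.eq_mk_of_hom g]
  hom_uniq := by
    rintro X _ ⟨c, rfl⟩ f g
    obtain rfl := A.str.eq_mk_of_hom f
    exact (A.str.τ_uniq X f).trans (A.str.τ_uniq X g).symm
  isTerm_fib_id X := A.isOperadic.fibre_id X _
  fib_obj_term := by
    rintro _ ⟨c, rfl⟩ ⟨Y, ⟨⟨⟩⟩, (f : Y ⟶ _)⟩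
    obtain rfl := A.str.eq_mk_of_hom f
    obtain rfl := A.str.τ_uniq Y f
    exact A.isOperadic.fibre_τ Y _
  fib_map_term := by
    rintro _ ⟨c, rfl⟩ _ _ u
    induction u using over_hom_induction with
    | @homMk Z Y g f =>
      obtain rfl := A.str.eq_mk_of_hom f
      obtain rfl := A.str.τ_uniq Y f
      exact A.isOperadic.fibreMap_τ g _
  fib_obj_fib_map u := by
    induction u using over_hom_induction with
    | homMk g f => exact A.fibre_fibreMap_point hA g f
  fib_map_fib_map w u := by
    induction w, u using over_hom_hom_induction with
    | homMk h g f => exact A.fibreMap_fibreMap_point hA h g f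

variable {A} {B : OpCat.{u}} {hA} {hB : isUnary B}

theorem IsOperadicFunctor.isMap {F : A.carrier ⥤ B.carrier} (hF : IsOperadicFunctor F) :
    (A.unaryStructure hA).IsMap (B.unaryStructure hB) F where
  isTerm := by
    rintro _ ⟨c, rfl⟩
    refine ⟨_, Eq.trans ?_ (hF.map_u (A.str.term c))⟩
    rw [LocalTerminals.u, A.str.term_mem]
  fib_comp X := by
    have hpoint : Fin.cast (congrArg (fun G : A.carrier ⥤ FinOrdinal => (G.obj X).n)
        hF.comp_card.symm) (A.point hA X) = B.point hB (F.obj X) :=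
      (subsingleton_card hB (F.obj X)).elim _ _
    refine Functor.hext ?_ fun _ _ u => ?_
    · rintro ⟨Y, ⟨⟨⟩⟩, (f : Y ⟶ X)⟩
      exact (hF.map_fibre f _).trans (congrArg (B.str.fibre (F.map f)) hpoint)
    · induction u using over_hom_induction with
      | homMk g f =>
        have hmap := hF.map_fibreMap g f (A.point hA X)
        rw [hpoint] at hmap
        exact hmap.trans (map_homMk_heq _ (F.map_comp g f).symm rfl (F.map_comp g f).symm)

theorem isOperadicFunctor_of_isMap {F : A.carrier ⥤ B.carrier}
    (hF : (A.unaryStructure hA).IsMap (B.unaryStructure hB) F) : IsOperadicFunctor F := by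
  have hcard : F ⋙ B.str.card = A.str.card :=
    Functor.hext (fun X => (hB _).trans (hA X).symm) fun X Y f =>
      FinOrdinal.hom_heq ((hB _).trans (hA X).symm) (hB _) (hA _) _ _
  have eq_point (X : A.carrier) (i : Fin (A.str.card.obj X).n) : i = A.point hA X :=
    (subsingleton_card hA X).elim _ _
  have cast_point (X : A.carrier) :
      Fin.cast (congrArg (fun G : A.carrier ⥤ FinOrdinal => (G.obj X).n) hcard.symm)
        (A.point hA X) = B.point hB (F.obj X) :=
    (subsingleton_card hB (F.obj X)).elim _ _
  exact
  { map_u X := by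
      obtain ⟨c, hc⟩ := hF.isTerm ⟨_, (rfl : A.str.u X = _)⟩
      have f : F.obj X ⟶ B.str.term c := F.map (A.str.τ X) ≫ eqToHom hc
      rw [hc, B.str.eq_mk_of_hom f]
    comp_card := hcard
    map_fibre {Y X} f i := by
      obtain rfl := eq_point X i
      rw [cast_point]
      exact Functor.congr_obj (hF.fib_comp X) (Over.mk f)
    map_fibreMap {Z Y X} g f i := by
      obtain rfl := eq_point X i
      rw [cast_point]
      exact (Functor.hcongr_hom (hF.fib_comp X)
        (Over.homMk g : Over.mk (g ≫ f) ⟶ Over.mk f)).trans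
          (map_homMk_heq _ (F.map_comp g f) (F.map_comp g f).symm rfl) }

end OpCat

namespace UnaryStructure

variable {C : Type u} [SmallCategory C] (S : UnaryStructure C)

/-- The chosen terminal object that an object maps to. -/
noncomputable def target (X : C) : C := (S.exists_term X).choose

theorem isTerm_target (X : C) : S.IsTerm (S.target X) := (S.exists_term X).choose_spec.1

/-- The map from an object to the chosen terminal object of its connected component. -/
noncomputable def toTarget (X : C) : X ⟶ S.target X := (S.exists_term X).choose_spec.2.some

theorem target_eq_of_hom {X T : C} (hT : S.IsTerm T) (f : X ⟶ T) : S.target X = T :=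
  S.term_uniq (S.isTerm_target X) hT (S.toTarget X) f

theorem target_eq_of_zigzag {X Y : C} (h : Zigzag X Y) : S.target X = S.target Y := by
  induction h with
  | refl => rfl
  | tail _ h ih =>
    refine ih.trans ?_
    rcases h with ⟨⟨f⟩⟩ | ⟨⟨f⟩⟩
    · exact S.target_eq_of_hom (S.isTerm_target _) (f ≫ S.toTarget _)
    · exact (S.target_eq_of_hom (S.isTerm_target _) (f ≫ S.toTarget _)).symm

/-- The data of an operadic category all of whose objects have cardinality `1`, determined by a
unary structure. -/
noncomputable def operadicData : OperadicData C where
  term := Quotient.lift S.target fun _ _ h => S.target_eq_of_zigzag h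
  term_mem := by
    rintro ⟨X⟩
    exact (Quotient.sound (Zigzag.of_hom (S.toTarget X))).symm
  τ := S.toTarget
  τ_uniq X _ := S.hom_uniq (S.isTerm_target X) _ _
  card :=
    { obj _ := FinOrdinal.one
      map _ := 𝟙 FinOrdinal.one }
  fibreFunctor X _ := S.fib X

theorem isTerm_iff (X : C) : S.IsTerm X ↔ ∃ c, X = S.operadicData.term c := by
  constructor
  · intro hX
    exact ⟨CategoryTheory.ConnectedComponents.mk X, (S.target_eq_of_hom hX (𝟙 X)).symm⟩
  · rintro ⟨⟨Y⟩, rfl⟩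
    exact S.isTerm_target Y

theorem isOperadic_operadicData : S.operadicData.IsOperadic where
  card_term _ := rfl
  fibre_id X _ := (S.isTerm_iff _).1 (S.isTerm_fib_id X)
  card_fibre _ _ := (FinOrdinal.fibre_of_eq_one rfl _ _).symm
  card_fibreMap _ _ _ :=
    FinOrdinal.hom_heq (FinOrdinal.fibre_of_eq_one rfl _ _).symm rfl
      (FinOrdinal.fibre_of_eq_one rfl _ _) _ _
  fibre_τ X _ := S.fib_obj_term (S.isTerm_target X) _
  fibreMap_τ {Y X} f _ := S.fib_map_term (S.isTerm_target X)
    (Over.homMk f : Over.mk (f ≫ S.toTarget X) ⟶ Over.mk (S.toTarget X))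
  fibre_fibreMap g f _ _ := S.fib_obj_fib_map (Over.homMk g : Over.mk (g ≫ f) ⟶ Over.mk f)
  fibreMap_fibreMap h g f _ _ :=
    (S.fib_map_fib_map (Over.homMk h : Over.mk (h ≫ g ≫ f) ⟶ Over.mk (g ≫ f))
      (Over.homMk g : _ ⟶ Over.mk f) :)

/-- The unary operadic category determined by a unary structure. -/
noncomputable def toUnaryOpCat : UnaryOpCat.{u} :=
  ⟨{ carrier := C, str := S.operadicData, isOperadic := S.isOperadic_operadicData }, fun _ => rfl⟩

theorem unaryStructure_toUnaryOpCat :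
    S.toUnaryOpCat.obj.unaryStructure S.toUnaryOpCat.property = S :=
  UnaryStructure.ext (funext fun X => propext (S.isTerm_iff X).symm) rfl

end UnaryStructure

/-- The nerve functor from unary operadic categories to simplicial sets. -/
def unaryNerve : UnaryOpCat.{u} ⥤ SSet.{u} where
  obj A := operadicNerve (A.obj.unaryStructure A.property)
  map f := operadicNerveMap f.hom.isOperadicFunctor.isMap

/-- The décalage of the nerve of a unary operadic category is the nerve of its underlying
category. -/
noncomputable def unaryNerveCompDec :
    unaryNerve.{u} ⋙ dec ≅ OpCat.isUnary.ι ⋙ OpCat.forget ⋙ nerveFunctor :=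
  NatIso.ofComponents (fun A => (asIso (decOperadicNerve (A.obj.unaryStructure A.property)) :))
    fun f => decOperadicNerve_naturality _ f.hom.isOperadicFunctor.isMap

instance : OpCat.forget.{u}.Faithful where
  map_injective h := OpCat.Hom.ext (congrArg Cat.Hom.toFunctor h)

instance : unaryNerve.{u}.Faithful :=
  have := Functor.Faithful.of_iso unaryNerveCompDec.symm
  Functor.Faithful.of_comp unaryNerve dec

instance : unaryNerve.{u}.Full where
  map_surjective φ := by
    obtain ⟨F, hF, rfl⟩ := exists_eq_operadicNerveMap φ
    exact ⟨⟨⟨F, OpCat.isOperadicFunctor_of_isMap hF⟩⟩, rfl⟩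

theorem isDecSegal_unaryNerve (A : UnaryOpCat.{u}) : isDecSegal (unaryNerve.obj A) :=
  isStrictSegal_of_iso (unaryNerveCompDec.app A).symm (Nerve.isStrictSegal A.obj.carrier)

theorem exists_nonempty_unaryNerve_iso {K : SSet.{u}} (hK : isDecSegal K) :
    ∃ A : UnaryOpCat.{u}, Nonempty (unaryNerve.obj A ≅ K) := by
  have : (dec.obj K).IsStrictSegal := hK
  let e : dec.obj K ≅ nerve (EdgeCategory (dec.obj K)) := asIso (toNerveEdgeCategory _)
  let S := DecNerve.unaryStructure e
  exact ⟨S.toUnaryOpCat, ⟨eqToIso (congrArg operadicNerve S.unaryStructure_toUnaryOpCat) ≪≫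
    (asIso (DecNerve.toOperadicNerve e)).symm⟩⟩

/-- The nerve functor from unary operadic categories to the simplicial sets whose décalage
satisfies the Segal condition. -/
def toDecSegal : UnaryOpCat.{u} ⥤ isDecSegal.{u}.FullSubcategory :=
  isDecSegal.lift unaryNerve isDecSegal_unaryNerve

instance : toDecSegal.{u}.IsEquivalence where
  full := inferInstanceAs (isDecSegal.lift unaryNerve _).Full
  faithful := inferInstanceAs (isDecSegal.lift unaryNerve _).Faithful
  essSurj := ⟨fun K =>
    let ⟨A, ⟨i⟩⟩ := exists_nonempty_unaryNerve_iso K.property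
    ⟨A, ⟨isDecSegal.isoMk i⟩⟩⟩

end Operadic

/-- The category of unary operadic categories is identified with the full subcategory of those
simplicial sets `C` whose décalage satisfies the Segal condition, in such a way that the décalage
of the simplicial set assigned to a unary operadic category is its nerve; and this full
subcategory is reflective. -/
theorem corollary1 :
    (∃ E : Operadic.UnaryOpCat.{u} ≌ Operadic.isDecSegal.{u}.FullSubcategory,
      Nonempty (E.functor ⋙ Operadic.isDecSegal.{u}.ι ⋙ Operadic.dec.{u} ≅
        Operadic.OpCat.isUnary.{u}.ι ⋙ Operadic.OpCat.forget.{u} ⋙ nerveFunctor.{u, u})) ∧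
    Nonempty (Reflective Operadic.isDecSegal.{u}.ι) :=
  ⟨⟨Operadic.toDecSegal.asEquivalence, ⟨Operadic.unaryNerveCompDec⟩⟩,
    Operadic.nonempty_reflective_isDecSegal⟩
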